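/- Let $b=(m_1,\dots,m_d)$ be a basis of $\mathbb R^d$, $M=[m_1,\dots,m_d]$, $\Lambda=M\mathbb Z^d$, $\Lambda^*=\{y: y\cdot\lambda\in\mathbb Z\ \forall \lambda\in\Lambda\}$ and $\Pi_\Lambda=M[0,1)^d$. Let $\Omega\subset\mathbb R^d$ be a $k$-tile for $\Lambda$, that is, a Lebesgue measurable set with $0<|\Omega|<\infty$ and $\sum_{\lambda\in\Lambda}\chi_\Omega(x-\lambda)=k$ for almost every $x\in\mathbb R^d$. For $x\in\Pi_\Lambda$ put $\Lambda_x=\{\lambda\in\Lambda: x+\lambda\in\Omega\}$. For a finite set $\mathcal M\subset\mathbb R^d$ and $1\le l\le d$, let $\mathcal M^{l}$ be its projection to the first $l$ coordinates ($\mathcal M^0$ consists of the empty vector if $\mathcal M\neq\emptyset$). For $m\in\mathcal M^{l-1}$ let $\mathcal Z^l_m=\{z\in\mathbb R:(m,z)\in\mathcal M^l\}$; thus $\mathcal Z^1=\mathcal M^1$. The shift index sets $\mathcal K^l(\mathcal M^l)\subset\mathbb Z_{\ge0}^l$ are defined by $\mathcal K^1(\mathcal M^1)=\{0,\dots,\#\mathcal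 M^1-1\}$ and, for $l\ge2$, $$\mathcal K^l(\mathcal M^l)=\{(j'',j): j''\in\mathcal K^{l-1}(\{m\in\mathcal M^{l-1}:\#\mathcal Z^l_m>j\})\}.$$ (Equivalently, if $\mathcal M^{l-1}=\{m_1,m_2,\dots\}$ is enumerated so that $N_i=\#\mathcal Z^l_{m_i}$ is nondecreasing and $N_0=0$, then $\mathcal K^l(\mathcal M^l)=\bigcup_i\mathcal K^{l-1}(\{m_p:p\ge i\})\times\{N_{i-1},\dots,N_i-1\}$.) Let $v\in\mathbb R^d$ and $q\in\mathbb Z_{>0}^d$, and suppose that $\Omega$ is strongly $(v,q)$-admissible: for almost every $x\in\Pi_\Lambda$, with $\mathcal M=\Lambda_x$, for all $1\le l\le d$ and all $m\in\mathcal M^{l-1}$, the numbers $v_lz$, $z\in\mathcal Z^l_m$, are integers and are pairwise distinct modulo $q_l$. Let $\delta$ be the diagonal matrix with entries $\delta_{ll}=v_l/q_l$. A family $\{e_l\}_{l\in L}$ is a Riesz basis of $L^2(\Omega)$ if there are constants $0<A\le B<\infty$ such that every $f\in L^2(\Omega)$ has a unique (unconditionally convergent) expansion $f=\sum_{l\in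 L}c_le_l$, and $A\|f\|^2\le\sum_{l\in L}|c_l|^2\le B\|f\|^2$. Write $e_l(x)=e^{2\pi i l\cdot x}$. Then: 1. There are $a_1,\dots,a_k\in\mathbb R^d$ such that $\{e_l\}_{l\in L}$, $L=\bigcup_{s=1}^k(\Lambda^*+a_s)$, is a Riesz basis of $L^2(\Omega)$. 2. If the set $\mathcal K^d(\Lambda_x)$ is the same set $\mathcal K$ for almost every $x\in\Pi_\Lambda$ (which always holds for $d=1$), then $\#\mathcal K=k$ and, for every $\eta\in\Lambda^*$, $\{e_l\}_{l\in L}$ with $L=\bigcup_{j\in\mathcal K}(\Lambda^*+\delta j+\eta)$ is a Riesz basis of $L^2(\Omega)$. 3. In general, there are constants $0<\alpha<\beta<\infty$ such that for almost every $x\in\Pi_\Lambda$ one has $\#\Lambda_x=\#\mathcal K^d(\Lambda_x)=k$, and for every $\eta\in\Lambda^*$ and all enumerations $\Lambda_x=\{\lambda_1,\dots,\lambda_k\}$, $\mathcal K^d(\Lambda_x)=\{j_1,\dots,j_k\}$, all singular values of the matrix $\bigl(e^{-2\pi i\lambda_r\cdot(\delta j_s+\eta)}\bigr)_{1\le s,r\le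 k}$ lie in $(\alpha,\beta)$. -/

import Mathlib

open MeasureTheory
open scoped ENNReal

noncomputable section

/-! ### Lattices, multi-tiles and Riesz bases of exponentials -/

/-- The full lattice `M ℤ^d` generated by the basis `b` (the columns of `M`). -/
def latticeOf {d : ℕ} (b : Module.Basis (Fin d) ℝ (EuclideanSpace ℝ (Fin d))) :
    Submodule ℤ (EuclideanSpace ℝ (Fin d)) :=
  Submodule.span ℤ (Set.range b)

/-- The dual lattice: all `y` with `⟪y, m⟫ ∈ ℤ` for every lattice point `m`. -/
def dualLatticeOf {d : ℕ} (b : Module.Basis (Fin d) ℝ (EuclideanSpace ℝ (Fin d))) :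
    Submodule ℤ (EuclideanSpace ℝ (Fin d)) :=
  LinearMap.BilinForm.dualSubmodule (innerₗ (EuclideanSpace ℝ (Fin d))) (latticeOf b)

/-- `Ω` is a `k`-tile for the lattice: a Lebesgue measurable set of finite positive measure whose
lattice translates cover almost every point exactly `k` times. -/
structure IsMultiTile {d : ℕ} (b : Module.Basis (Fin d) ℝ (EuclideanSpace ℝ (Fin d)))
    (k : ℕ) (Ω : Set (EuclideanSpace ℝ (Fin d))) : Prop where
  nullMeasurableSet : NullMeasurableSet Ω volume
  volume_pos : 0 < volume Ω
  volume_lt_top : volume Ω < ∞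
  tsum_eq : ∀ᵐ x : EuclideanSpace ℝ (Fin d),
    ∑' m : latticeOf b, Ω.indicator (fun _ => (1 : ℝ≥0∞)) (x - (m : EuclideanSpace ℝ (Fin d))) = k

/-- A family `e` in a Hilbert space is a Riesz basis: every `f` has a unique expansion
`f = ∑ c_i e_i`, and its coefficients are square summable with
`A ‖f‖² ≤ ∑ |c_i|² ≤ B ‖f‖²`, for constants `0 < A ≤ B < ∞` that do not depend on `f`. -/
def IsRieszBasis {ι H : Type*} [NormedAddCommGroup H] [InnerProductSpace ℂ H] (e : ι → H) : Prop :=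
  ∃ A B : ℝ, 0 < A ∧ A ≤ B ∧ ∀ f : H, ∃ c : ι → ℂ,
    HasSum (fun i => c i • e i) f ∧
    (∀ c' : ι → ℂ, HasSum (fun i => c' i • e i) f → c' = c) ∧
    Summable (fun i => ‖c i‖ ^ 2) ∧
    A * ‖f‖ ^ 2 ≤ ∑' i, ‖c i‖ ^ 2 ∧ ∑' i, ‖c i‖ ^ 2 ≤ B * ‖f‖ ^ 2

/-- The exponential `e_l(x) = exp(2πi l·x)`. -/
def expFun {d : ℕ} (l x : EuclideanSpace ℝ (Fin d)) : ℂ :=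
  Complex.exp (2 * Real.pi * Complex.I * (inner ℝ l x : ℝ))

/-- The exponentials `e_l`, `l ∈ L`, belong to `L²(Ω)` and form a Riesz basis of it. -/
def IsRieszBasisOfExponentials {d : ℕ} (Ω L : Set (EuclideanSpace ℝ (Fin d))) : Prop :=
  ∃ e : L → Lp ℂ 2 (volume.restrict Ω),
    (∀ l : L, e l =ᵐ[volume.restrict Ω] expFun (l : EuclideanSpace ℝ (Fin d))) ∧ IsRieszBasis e

/-- `⋃_{a ∈ S} (Λ* + a)`, for a set `S` of shifts. -/
def shiftedDual {d : ℕ} (b : Module.Basis (Fin d) ℝ (EuclideanSpace ℝ (Fin d)))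
    (S : Set (EuclideanSpace ℝ (Fin d))) : Set (EuclideanSpace ℝ (Fin d)) :=
  ⋃ a ∈ S, {l | l - a ∈ dualLatticeOf b}

/-! ### Frequency sets, admissibility and shift index sets -/

/-- The frequency set `Λ_x = {m ∈ Λ | x + m ∈ Ω}`. -/
def freqPoints {d : ℕ} (b : Module.Basis (Fin d) ℝ (EuclideanSpace ℝ (Fin d)))
    (Ω : Set (EuclideanSpace ℝ (Fin d))) (x : EuclideanSpace ℝ (Fin d)) :
    Set (EuclideanSpace ℝ (Fin d)) :=
  {m | m ∈ latticeOf b ∧ x + m ∈ Ω}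

/-- `Λ_x` as a set of coordinate vectors. -/
def freqSet {d : ℕ} (b : Module.Basis (Fin d) ℝ (EuclideanSpace ℝ (Fin d)))
    (Ω : Set (EuclideanSpace ℝ (Fin d))) (x : EuclideanSpace ℝ (Fin d)) : Set (Fin d → ℝ) :=
  WithLp.ofLp '' freqPoints b Ω x

/-- For `w ∈ M`: the `l`-th coordinates of the points of `M` that have the same first coordinates
`w_i`, `i < l`, as `w`. As `w` runs through `M`, these are the sets of children of the vectors
in the projection of `M` to the coordinates before `l`. For the first coordinate, `children M l w`
is the projection of `M` to that coordinate. -/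
def children {d : ℕ} (M : Set (Fin d → ℝ)) (l : Fin d) (w : Fin d → ℝ) : Set ℝ :=
  {z | ∃ y ∈ M, (∀ i, i < l → y i = w i) ∧ y l = z}

/-- In each set of children, the numbers `v_l z` are distinct modulo `q_l`, for almost every `x` in
the fundamental domain `M [0,1)^d`. -/
def WeaklyAdmissible {d : ℕ} (b : Module.Basis (Fin d) ℝ (EuclideanSpace ℝ (Fin d)))
    (Ω : Set (EuclideanSpace ℝ (Fin d))) (v : Fin d → ℝ) (q : Fin d → ℕ) : Prop :=
  ∀ᵐ x ∂(volume.restrict (ZSpan.fundamentalDomain b)), ∀ l : Fin d, ∀ w ∈ freqSet b Ω x,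
    ((fun z : ℝ => ((v l * z : ℝ) : AddCircle (q l : ℝ))) '' children (freqSet b Ω x) l w).ncard =
      (children (freqSet b Ω x) l w).ncard

/-- Weak admissibility, and the residues modulo `q_l` of the numbers `v_l z` are integers
(since `q_l` is an integer, this says that the numbers `v_l z` are). -/
def StronglyAdmissible {d : ℕ} (b : Module.Basis (Fin d) ℝ (EuclideanSpace ℝ (Fin d)))
    (Ω : Set (EuclideanSpace ℝ (Fin d))) (v : Fin d → ℝ) (q : Fin d → ℕ) : Prop :=
  WeaklyAdmissible b Ω v q ∧
  ∀ᵐ x ∂(volume.restrict (ZSpan.fundamentalDomain b)), ∀ l : Fin d, ∀ w ∈ freqSet b Ω x,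
    ∀ z ∈ children (freqSet b Ω x) l w, ∃ n : ℤ, v l * z = n

/-- The shift index set `K^l(M)` of a finite `M ⊆ ℝ^l`: a vector `(j'', j)` lies in `K^{l+1}(M)` iff
`j''` lies in `K^l(M')`, where `M'` consists of the vectors in the projection of `M` to the first `l`
coordinates that have more than `j` children. If the projection is enumerated as `m_1, m_2, …` with
increasing numbers `N_i` of children, then `M' = {m_p | p ≥ i}` for `N_{i-1} ≤ j < N_i`, so that
`K^{l+1}(M) = ⋃_i K^l({m_p | p ≥ i}) × {N_{i-1}, …, N_i - 1}` (proved below), and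
`K^1(M) = {0, …, #M - 1}`. -/
def shiftIndex : (l : ℕ) → Set (Fin l → ℝ) → Set (Fin l → ℕ)
  | 0, M => {_j | M.Nonempty}
  | l + 1, M => {j | (Fin.init j : Fin l → ℕ) ∈ shiftIndex l
      ((fun w : Fin (l + 1) → ℝ => (Fin.init w : Fin l → ℝ)) ''
        {w ∈ M | j (Fin.last l) < (children M (Fin.last l) w).ncard})}

theorem shiftIndex_empty (l : ℕ) : shiftIndex l ∅ = ∅ := by
  induction l with
  | zero => simp [shiftIndex]
  | succ l ih => simp [shiftIndex, ih]

theorem shiftIndex_one (M : Set (Fin 1 → ℝ)) : shiftIndex 1 M = {j | j 0 < M.ncard} := by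
  have key : ∀ w : Fin 1 → ℝ, (children M 0 w).ncard = M.ncard := by
    intro w
    have : children M 0 w = (fun y : Fin 1 → ℝ => y 0) '' M := by
      ext z
      simp [children]
    rw [this]
    refine Set.ncard_image_of_injective _ fun y y' h => ?_
    ext i
    rw [Subsingleton.elim i 0]
    exact h
  ext j
  simp only [shiftIndex, Set.image_nonempty, Set.mem_ofPred_eq, Fin.last_zero]
  constructor
  · rintro ⟨w, -, hw⟩
    rwa [key w] at hw
  · intro h
    obtain ⟨w, hw⟩ := Set.nonempty_of_ncard_ne_zero (s := M) (by change j 0 < _ at h; omega)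
    exact ⟨w, hw, by rw [key w]; exact h⟩

/-- The recursion for `shiftIndex`, written with an enumeration `m` of the projection of `M` in which
the numbers of children increase. -/
theorem shiftIndex_succ {l N : ℕ} (M : Set (Fin (l + 1) → ℝ)) (m : Fin N → (Fin l → ℝ))
    (hm : Set.range m = (fun w : Fin (l + 1) → ℝ => (Fin.init w : Fin l → ℝ)) '' M)
    (Z : Fin N → Set ℝ)
    (hZ : ∀ i, Z i = {z : ℝ | (Fin.snoc (m i) z : Fin (l + 1) → ℝ) ∈ M})
    (hmono : ∀ i i', i ≤ i' → (Z i).ncard ≤ (Z i').ncard) :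
    shiftIndex (l + 1) M = ⋃ i : Fin N, {j | (Fin.init j : Fin l → ℕ) ∈
        shiftIndex l (m '' {p | i ≤ p}) ∧
      (∀ p, p < i → (Z p).ncard ≤ j (Fin.last l)) ∧ j (Fin.last l) < (Z i).ncard} := by
  have hch : ∀ w ∈ M, ∀ i, m i = (Fin.init w : Fin l → ℝ) →
      children M (Fin.last l) w = Z i := by
    intro w _ i hi
    rw [hZ]
    ext z
    simp only [children, Set.mem_ofPred_eq]
    constructor
    · rintro ⟨y, hy, hyw, rfl⟩
      have : (Fin.snoc (m i) (y (Fin.last l)) : Fin (l + 1) → ℝ) = y := by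
        rw [hi]
        have : (Fin.init w : Fin l → ℝ) = Fin.init y := by
          ext p
          exact (hyw p.castSucc (Fin.castSucc_lt_last p)).symm
        rw [this, Fin.snoc_init_self]
      rwa [this]
    · intro h
      refine ⟨_, h, ?_, by simp⟩
      intro p hp
      obtain ⟨p', rfl⟩ := Fin.exists_castSucc_eq.mpr hp.ne
      rw [Fin.snoc_castSucc, hi]
      rfl
  have hset : ∀ n : ℕ, (fun w : Fin (l + 1) → ℝ => (Fin.init w : Fin l → ℝ)) ''
      {w ∈ M | n < (children M (Fin.last l) w).ncard} = m '' {p | n < (Z p).ncard} := by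
    intro n
    ext u
    constructor
    · rintro ⟨w, ⟨hw, hn⟩, rfl⟩
      have : (Fin.init w : Fin l → ℝ) ∈ Set.range m := hm ▸ ⟨w, hw, rfl⟩
      obtain ⟨i, hi⟩ := this
      exact ⟨i, by rw [hch w hw i hi] at hn; exact hn, hi⟩
    · rintro ⟨i, hn, rfl⟩
      have : m i ∈ (fun w : Fin (l + 1) → ℝ => (Fin.init w : Fin l → ℝ)) '' M := hm ▸ ⟨i, rfl⟩
      obtain ⟨w, hw, hwi⟩ := this
      exact ⟨w, ⟨hw, by rw [hch w hw i hwi.symm]; exact hn⟩, hwi⟩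
  have hup : ∀ (n : ℕ) (i : Fin N), (∀ p, p < i → (Z p).ncard ≤ n) → n < (Z i).ncard →
      {p | n < (Z p).ncard} = {p | i ≤ p} := by
    intro n i h1 h2
    ext p
    simp only [Set.mem_ofPred_eq]
    constructor
    · intro h
      by_contra hlt
      exact absurd (h1 p (not_le.mp hlt)) (not_le.mpr h)
    · intro h
      exact lt_of_lt_of_le h2 (hmono _ _ h)
  ext j
  simp only [shiftIndex, Set.mem_iUnion, Set.mem_ofPred_eq, hset]
  constructor
  · intro h
    have hex : ∃ i : Fin N, j (Fin.last l) < (Z i).ncard := by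
      by_contra hcon
      push Not at hcon
      have : {p : Fin N | j (Fin.last l) < (Z p).ncard} = ∅ := by
        ext p
        simpa using hcon p
      rw [this, Set.image_empty, shiftIndex_empty] at h
      exact h
    obtain ⟨i, hi, hmin⟩ := (Set.toFinite {p : Fin N | j (Fin.last l) < (Z p).ncard}).exists_minimal
      hex
    have h1 : ∀ p, p < i → (Z p).ncard ≤ j (Fin.last l) := by
      intro p hp
      by_contra hcon
      exact absurd (hmin (not_le.mp hcon) hp.le) (not_le.mpr hp)
    exact ⟨i, by rw [← hup _ i h1 hi]; exact h, h1, hi⟩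
  · rintro ⟨i, h, h1, h2⟩
    rw [hup _ i h1 h2]
    exact h

/-- The shift `a = δ j + η`, where `δ` is the diagonal matrix with entries `v_l / q_l`. -/
def shiftVec {d : ℕ} (v : Fin d → ℝ) (q : Fin d → ℕ) (η : EuclideanSpace ℝ (Fin d))
    (j : Fin d → ℕ) : EuclideanSpace ℝ (Fin d) :=
  WithLp.toLp 2 (fun l => v l / (q l : ℝ) * (j l : ℝ)) + η

/-- The `k × k` matrix with entries `exp(-2πi λ_r · a_s)` (row `s`, column `r`). -/
def expMatrix {d k : ℕ} (a lam : Fin k → EuclideanSpace ℝ (Fin d)) : Matrix (Fin k) (Fin k) ℂ :=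
  Matrix.of fun s r => Complex.exp (-(2 * Real.pi * Complex.I * (inner ℝ (lam r) (a s) : ℝ)))

end

/-! ### Shift index sets -/

/-! Unfolding along the lattice identifies `f` on `Ω` with the vectors `(f (x + λ_r))_r`, where `x`
lies in the fundamental domain and `λ_1, …, λ_k` enumerate `Λ_x`. Let `V(x)` be the matrix with
entries `exp(-2πi λ_r · a_s)`. Since dual lattice exponentials equal 1 on the lattice, a finite
combination of the frequencies `Λ* + a_s` unfolds to `V(x)ᴴ` applied to `(e_{a_s}(x) p_s(x))_s`,
with trigonometric polynomials `p_s` having frequencies in `Λ*`. These frequencies are orthogonal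
and complete on the fundamental domain. Hence uniform bounds on `V(x)ᴴ` give the Riesz inequalities
(`exists_bounds_lintegral_sum_expFun`), and injectivity of `V(x)` gives completeness
(`eq_zero_of_forall_integral_conj_expFun`).

For both choices of shifts, strong admissibility makes every entry of `V(x)` a root of unity of
order dividing `∏ q_l`. Only finitely many matrices can then occur, so invertibility of each one is
automatically uniform in `x`.

For the shifts `δ j + η` the entries are monomials `∏ u_l(λ_l)^{j_l}` with exponents in the shift
index set. A combination of them vanishing on `Λ_x` is a polynomial in the last variable. Its
coefficients are killed from the top degree down, since a polynomial of degree at most `t` vanishes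
if it has more than `t` roots; each coefficient is handled by induction on the dimension
(`coeff_eq_zero_of_sum_shiftIndex`). The count `ncard_shiftIndex` makes the matrix square.

For shifts independent of `x`, multiples `s • w` of a single vector suffice: the matrix is then
Vandermonde, and a mixed-radix choice of `w` makes its nodes distinct
(`AdmissibleSet.exp_radixVec_injOn`). -/

theorem children_init_subset {l : ℕ} {M : Set (Fin (l + 1) → ℝ)} {S : Set (Fin (l + 1) → ℝ)}
    (hS : S ⊆ M) (i : Fin l) (w : Fin (l + 1) → ℝ) :
    children ((fun w : Fin (l + 1) → ℝ => (Fin.init w : Fin l → ℝ)) '' S) i (Fin.init w) ⊆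
      children M i.castSucc w := by
  rintro z ⟨_, ⟨y, hy, rfl⟩, h1, rfl⟩
  refine ⟨y, hS hy, fun p hp => ?_, rfl⟩
  have hpl : p ≠ Fin.last l := (hp.trans (Fin.castSucc_lt_last i)).ne
  obtain ⟨p', rfl⟩ := Fin.exists_castSucc_eq.mpr hpl
  exact h1 p' (by simpa using hp)

theorem children_finite {d : ℕ} {M : Set (Fin d → ℝ)} (hM : M.Finite) (l : Fin d)
    (w : Fin d → ℝ) : (children M l w).Finite :=
  (hM.image fun y => y l).subset fun _ ⟨y, hy, _, hz⟩ => ⟨y, hy, hz⟩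

/-- The projections of the points with more than `t` children. -/
def projMore {l : ℕ} (M : Set (Fin (l + 1) → ℝ)) (t : ℕ) : Set (Fin l → ℝ) :=
  (fun w : Fin (l + 1) → ℝ => (Fin.init w : Fin l → ℝ)) ''
    {w ∈ M | t < (children M (Fin.last l) w).ncard}

theorem mem_shiftIndex_succ {l : ℕ} {M : Set (Fin (l + 1) → ℝ)} {j : Fin (l + 1) → ℕ} :
    j ∈ shiftIndex (l + 1) M ↔
      (Fin.init j : Fin l → ℕ) ∈ shiftIndex l (projMore M (j (Fin.last l))) := Iff.rfl

theorem projMore_finite {l : ℕ} {M : Set (Fin (l + 1) → ℝ)} (hM : M.Finite) (t : ℕ) :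
    (projMore M t).Finite :=
  (hM.subset (Set.sep_subset _ _)).image _

theorem ncard_children_le {d : ℕ} {M : Set (Fin d → ℝ)} (hM : M.Finite) (l : Fin d)
    (w : Fin d → ℝ) : (children M l w).ncard ≤ M.ncard :=
  (Set.ncard_le_ncard (fun _ ⟨y, hy, _, hz⟩ => ⟨y, hy, hz⟩ : children M l w ⊆ (fun y => y l) '' M)
    (hM.image _)).trans (Set.ncard_image_le hM)

theorem projMore_eq_empty {l : ℕ} {M : Set (Fin (l + 1) → ℝ)} (hM : M.Finite) {t : ℕ}
    (ht : M.ncard ≤ t) : projMore M t = ∅ := by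
  rw [projMore, Set.image_eq_empty]
  ext w
  simpa using fun _ => (ncard_children_le hM _ w).trans ht

theorem shiftIndex_succ_eq_iUnion {l : ℕ} {M : Set (Fin (l + 1) → ℝ)} (hM : M.Finite) :
    shiftIndex (l + 1) M = ⋃ t ∈ Finset.range M.ncard,
      (fun j : Fin l → ℕ => (Fin.snoc j t : Fin (l + 1) → ℕ)) '' shiftIndex l (projMore M t) := by
  ext j
  rw [mem_shiftIndex_succ]
  simp only [Finset.mem_range, Set.mem_iUnion, Set.mem_image, exists_prop]
  constructor
  · intro h
    refine ⟨j (Fin.last l), ?_, _, h, Fin.snoc_init_self j⟩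
    by_contra hcon
    rw [projMore_eq_empty hM (not_lt.mp hcon), shiftIndex_empty] at h
    exact h
  · rintro ⟨t, -, j', hj', rfl⟩
    simpa using hj'

theorem shiftIndex_finite : ∀ {d : ℕ} {M : Set (Fin d → ℝ)}, M.Finite → (shiftIndex d M).Finite
  | 0, _, _ => Set.toFinite _
  | l + 1, M, hM => by
    rw [shiftIndex_succ_eq_iUnion hM]
    exact Set.Finite.biUnion (Finset.finite_toSet _) fun t _ =>
      (shiftIndex_finite (projMore_finite hM t)).image _

theorem snoc_left_inj {l : ℕ} (t : ℕ) :
    Function.Injective fun j : Fin l → ℕ => (Fin.snoc j t : Fin (l + 1) → ℕ) := fun j j' h => by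
  simpa using congrArg (fun f : Fin (l + 1) → ℕ => (Fin.init f : Fin l → ℕ)) h

/-- Layer-cake count: a fibre of the projection with `N` points contributes one point to each of the
levels `t = 0, …, N - 1`. -/
theorem ncard_eq_sum_ncard_projMore {l : ℕ} {M : Set (Fin (l + 1) → ℝ)} (hM : M.Finite) :
    M.ncard = ∑ t ∈ Finset.range M.ncard, (projMore M t).ncard := by
  classical
  set π : (Fin (l + 1) → ℝ) → (Fin l → ℝ) := fun w => Fin.init w with hπ
  have hfib : ∀ w ∈ M, (children M (Fin.last l) w).ncard = {y ∈ M | π y = π w}.ncard := by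
    intro w _
    have : children M (Fin.last l) w = (fun y => y (Fin.last l)) '' {y ∈ M | π y = π w} := by
      ext z
      constructor
      · rintro ⟨y, hy, h1, h2⟩
        exact ⟨y, ⟨hy, funext fun p => h1 _ (Fin.castSucc_lt_last p)⟩, h2⟩
      · rintro ⟨y, ⟨hy, h1⟩, h2⟩
        refine ⟨y, hy, fun i hi => ?_, h2⟩
        obtain ⟨p, rfl⟩ := Fin.exists_castSucc_eq.mpr hi.ne
        exact congrFun h1 p
    rw [this]
    refine Set.InjOn.ncard_image fun y hy y' hy' h => ?_
    rw [← Fin.snoc_init_self y, ← Fin.snoc_init_self y']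
    have h1 : (Fin.init y : Fin l → ℝ) = Fin.init y' := hy.2.trans hy'.2.symm
    have h2 : y (Fin.last l) = y' (Fin.last l) := h
    rw [h1, h2]
  obtain ⟨F, rfl⟩ := hM.exists_finset_coe
  have h1 : ∀ t, (projMore (F : Set (Fin (l + 1) → ℝ)) t).ncard =
      ((F.image π).filter fun u => t < (F.filter fun y => π y = u).card).card := by
    intro t
    rw [← Set.ncard_coe_finset]
    congr 1
    ext u
    simp only [projMore, Set.mem_image, Set.mem_ofPred_eq, Finset.coe_filter, Finset.mem_image]
    constructor
    · rintro ⟨w, ⟨hw, ht⟩, rfl⟩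
      refine ⟨⟨w, hw, rfl⟩, ?_⟩
      rw [hfib w hw] at ht
      rw [← Set.ncard_coe_finset]
      simpa using ht
    · rintro ⟨⟨w, hw, rfl⟩, ht⟩
      refine ⟨w, ⟨hw, ?_⟩, rfl⟩
      rw [hfib w hw]
      rw [← Set.ncard_coe_finset] at ht
      simpa using ht
  have h2 : F.card = ∑ u ∈ F.image π, (F.filter fun y => π y = u).card :=
    Finset.card_eq_sum_card_image π F
  have h3 : ∀ u, (F.filter fun y => π y = u).card ≤ F.card := fun u => Finset.card_filter_le _ _
  simp_rw [h1, Set.ncard_coe_finset]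
  have h4 : ∀ N : (Fin l → ℝ) → ℕ, (∀ u, N u ≤ F.card) → ∑ u ∈ F.image π, N u =
      ∑ t ∈ Finset.range F.card, ((F.image π).filter fun u => t < N u).card := by
    intro N hN
    simp_rw [Finset.card_filter]
    rw [Finset.sum_comm]
    refine Finset.sum_congr rfl fun u _ => ?_
    rw [← Finset.card_filter]
    have : (Finset.range F.card).filter (fun t => t < N u) = Finset.range (N u) := by
      ext t
      simp only [Finset.mem_filter, Finset.mem_range, and_iff_right_iff_imp]
      exact fun h => h.trans_le (hN u)
    rw [this, Finset.card_range]
  exact h2.trans (h4 _ h3)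

/-- The slices of the index set by last coordinate are disjoint, and by induction each has as many
elements as the corresponding level of the layer-cake count. -/
theorem ncard_shiftIndex : ∀ {d : ℕ} {M : Set (Fin d → ℝ)}, M.Finite →
    (shiftIndex d M).ncard = M.ncard
  | 0, M, _ => by
    rcases M.eq_empty_or_nonempty with rfl | hM
    · simp [shiftIndex_empty]
    · have h1 : shiftIndex 0 M = Set.univ := by simp [shiftIndex, hM]
      have h2 : M = Set.univ := by
        obtain ⟨w, hw⟩ := hM
        exact Set.eq_univ_of_forall fun y => Subsingleton.elim w y ▸ hw
      rw [h1, h2]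
      simp [Set.ncard_univ]
  | l + 1, M, hM => by
    classical
    rw [ncard_eq_sum_ncard_projMore hM]
    have hfin : ∀ t, (shiftIndex l (projMore M t)).Finite := fun t =>
      shiftIndex_finite (projMore_finite hM t)
    have : shiftIndex (l + 1) M = ↑((Finset.range M.ncard).biUnion fun t =>
        (hfin t).toFinset.image fun j : Fin l → ℕ => (Fin.snoc j t : Fin (l + 1) → ℕ)) := by
      rw [shiftIndex_succ_eq_iUnion hM]
      simp
    rw [this, Set.ncard_coe_finset, Finset.card_biUnion]
    · refine Finset.sum_congr rfl fun t _ => ?_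
      rw [Finset.card_image_of_injective _ (snoc_left_inj t), ← Set.ncard_eq_toFinset_card _ (hfin t),
        ncard_shiftIndex (projMore_finite hM t)]
    · intro t _ t' _ htt'
      rw [Function.onFun, Finset.disjoint_left]
      intro j hj hj'
      obtain ⟨j1, -, rfl⟩ := Finset.mem_image.mp hj
      obtain ⟨j2, -, h⟩ := Finset.mem_image.mp hj'
      exact htt' (by simpa using (congrFun h (Fin.last l)).symm)

/-- The monomials with exponents in `shiftIndex d M` are linearly independent on the points
`(u_i (y_i))_i`, `y ∈ M`, provided that each `u_i` separates siblings. -/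
theorem coeff_eq_zero_of_sum_shiftIndex : ∀ {d : ℕ} {M : Set (Fin d → ℝ)} (hM : M.Finite)
    (u : Fin d → ℝ → ℂ), (∀ l, ∀ w ∈ M, Set.InjOn (u l) (children M l w)) →
    ∀ c : (Fin d → ℕ) → ℂ,
      (∀ y ∈ M, ∑ j ∈ (shiftIndex_finite hM).toFinset, c j * ∏ i, u i (y i) ^ j i = 0) →
      ∀ j ∈ shiftIndex d M, c j = 0
  | 0, M, hM, u, _, c, hc, j, hj => by
    have hj0 := hj
    obtain ⟨y, hy⟩ : M.Nonempty := hj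
    have h := hc y hy
    rwa [Finset.sum_eq_single j (fun j' _ hne => (hne (Subsingleton.elim _ _)).elim)
      (fun h => (h ((Set.Finite.mem_toFinset _).mpr hj0)).elim), Finset.univ_eq_empty, Finset.prod_empty,
      mul_one] at h
  | l + 1, M, hM, u, hu, c, hc, j, hj => by
    classical
    have hfin : ∀ t, (shiftIndex l (projMore M t)).Finite := fun t =>
      shiftIndex_finite (projMore_finite hM t)
    -- `p t` is the coefficient of the `t`-th power of the last variable.
    set p : ℕ → (Fin l → ℝ) → ℂ := fun t y' => ∑ j' ∈ (hfin t).toFinset,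
      c (Fin.snoc j' t : Fin (l + 1) → ℕ) * ∏ i, u i.castSucc (y' i) ^ j' i with hp
    have hsum : ∀ y ∈ M, ∑ t ∈ Finset.range M.ncard,
        p t (Fin.init y) * u (Fin.last l) (y (Fin.last l)) ^ t = 0 := by
      intro y hy
      rw [← hc y hy]
      have hK : (shiftIndex_finite hM).toFinset = (Finset.range M.ncard).biUnion fun t =>
          (hfin t).toFinset.image fun j : Fin l → ℕ => (Fin.snoc j t : Fin (l + 1) → ℕ) := by
        apply Finset.coe_injective
        rw [Set.Finite.coe_toFinset, shiftIndex_succ_eq_iUnion hM]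
        simp
      rw [hK, Finset.sum_biUnion]
      · refine Finset.sum_congr rfl fun t _ => ?_
        rw [Finset.sum_image fun _ _ _ _ h => snoc_left_inj t h, hp, Finset.sum_mul]
        refine Finset.sum_congr rfl fun j' _ => ?_
        rw [Fin.prod_univ_castSucc]
        simp [Fin.init, mul_assoc]
      · intro t _ t' _ htt'
        rw [Function.onFun, Finset.disjoint_left]
        rintro j hj hj'
        obtain ⟨j1, -, rfl⟩ := Finset.mem_image.mp hj
        obtain ⟨j2, -, h⟩ := Finset.mem_image.mp hj'
        exact htt' (by simpa using (congrFun h (Fin.last l)).symm)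
    -- Descending induction on the level `t`, written as induction on `n`; levels `t ≥ M.ncard` are
    -- empty.
    have key : ∀ n t, M.ncard ≤ t + n → ∀ j' ∈ shiftIndex l (projMore M t),
        c (Fin.snoc j' t : Fin (l + 1) → ℕ) = 0 := by
      intro n
      induction n with
      | zero =>
        intro t ht j' hj'
        rw [projMore_eq_empty hM (t := t) ht, shiftIndex_empty] at hj'
        exact hj'.elim
      | succ n ih =>
        intro t ht
        by_cases htN : M.ncard ≤ t
        · exact ih t (htN.trans (Nat.le_add_right _ _))
        have hp0 : ∀ s, t < s → ∀ y', p s y' = 0 := fun s hs y' =>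
          Finset.sum_eq_zero fun j' hj' => by
            rw [ih s (by omega) j' (by simpa using hj'), zero_mul]
        refine coeff_eq_zero_of_sum_shiftIndex (projMore_finite hM t) (fun i => u i.castSucc) ?_
          (fun j' => c (Fin.snoc j' t : Fin (l + 1) → ℕ)) ?_
        · rintro i _ ⟨w, hw, rfl⟩
          -- Separation of siblings is inherited, because sets of children only shrink under the
          -- projection.
          exact (hu i.castSucc w hw.1).mono
            (children_init_subset (M := M) (fun _ h => h.1) i w)
        · rintro _ ⟨w, ⟨hw, hwt⟩, rfl⟩
          change p t (Fin.init w) = 0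
          set P : Polynomial ℂ := ∑ s ∈ Finset.range (t + 1),
            Polynomial.C (p s (Fin.init w)) * Polynomial.X ^ s with hP
          have hdeg : P.natDegree < t + 1 := by
            refine Nat.lt_succ_of_le (Polynomial.natDegree_sum_le_of_forall_le _ _ fun s hs => ?_)
            exact (Polynomial.natDegree_C_mul_X_pow_le _ _).trans
              (Nat.lt_succ_iff.mp (Finset.mem_range.mp hs))
          have hchf := children_finite hM (Fin.last l) w
          -- The degree is at most `t`, while `w` has more than `t` children and `u` sends them to
          -- distinct roots; the terms above `t` in the full sum already vanish.
          have hP0 : P = 0 := by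
            refine Polynomial.eq_zero_of_natDegree_lt_card_of_eval_eq_zero' (R := ℂ) P
              (hchf.toFinset.image (u (Fin.last l))) ?_ ?_
            · intro ζ hζ
              obtain ⟨z, hz, rfl⟩ := Finset.mem_image.mp hζ
              obtain ⟨y, hy, h1, rfl⟩ := hchf.mem_toFinset.mp hz
              have hyw : (Fin.init y : Fin l → ℝ) = Fin.init w :=
                funext fun i => h1 _ (Fin.castSucc_lt_last i)
              rw [hP, Polynomial.eval_finsetSum]
              simp only [Polynomial.eval_mul, Polynomial.eval_C, Polynomial.eval_pow,
                Polynomial.eval_X]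
              rw [← hsum y hy, hyw]
              refine Finset.sum_subset (Finset.range_subset_range.mpr (by omega)) fun s _ hs => ?_
              rw [hp0 s (by rw [Finset.mem_range] at hs; omega), zero_mul]
            · rw [Finset.card_image_of_injOn (by rw [Set.Finite.coe_toFinset]; exact hu _ w hw),
                ← Set.ncard_eq_toFinset_card _ hchf]
              exact hdeg.trans_le hwt
          have := congrArg (fun R => Polynomial.coeff R t) hP0
          simpa [hP, Polynomial.coeff_C_mul, Polynomial.coeff_X_pow] using this
    have := key M.ncard (j (Fin.last l)) (by omega) (Fin.init j) hj
    rwa [Fin.snoc_init_self] at this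

/-! ### A criterion for Riesz bases -/

section RieszCriterion

variable {ι H : Type*} [NormedAddCommGroup H] [InnerProductSpace ℂ H]

theorem IsRieszBasis.of_comp_equiv {ι' : Type*} {e : ι → H} (σ : ι' ≃ ι)
    (h : IsRieszBasis fun i => e (σ i)) : IsRieszBasis e := by
  obtain ⟨A, B, hA, hAB, h⟩ := h
  refine ⟨A, B, hA, hAB, fun f => ?_⟩
  obtain ⟨c, hc, huniq, hsum, h1, h2⟩ := h f
  have hn : ∑' i, ‖c (σ.symm i)‖ ^ 2 = ∑' i, ‖c i‖ ^ 2 :=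
    σ.symm.tsum_eq fun i => ‖c i‖ ^ 2
  refine ⟨fun i => c (σ.symm i), ?_, fun c' hc' => ?_, ?_, hn ▸ h1, hn ▸ h2⟩
  · rw [← σ.hasSum_iff]
    simpa [Function.comp_def] using hc
  · have := huniq (fun i => c' (σ i)) (σ.hasSum_iff.mpr hc')
    funext i
    simpa using congrFun this (σ.symm i)
  · rw [← σ.summable_iff]
    simpa [Function.comp_def] using hsum

theorem le_of_hasSum_smul {e : ι → H} {A : ℝ}
    (hl : ∀ (S : Finset ι) (c : ι → ℂ), A * ∑ i ∈ S, ‖c i‖ ^ 2 ≤ ‖∑ i ∈ S, c i • e i‖ ^ 2)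
    {c : ι → ℂ} {f : H} (hc : HasSum (fun i => c i • e i) f) (hs : Summable fun i => ‖c i‖ ^ 2) :
    A * ∑' i, ‖c i‖ ^ 2 ≤ ‖f‖ ^ 2 :=
  le_of_tendsto_of_tendsto' (Filter.Tendsto.const_mul A hs.hasSum) (hc.norm.pow 2)
    fun S => hl S c

theorem norm_sq_le_of_hasSum_smul {e : ι → H} {B : ℝ}
    (hu : ∀ (S : Finset ι) (c : ι → ℂ), ‖∑ i ∈ S, c i • e i‖ ^ 2 ≤ B * ∑ i ∈ S, ‖c i‖ ^ 2)
    {c : ι → ℂ} {f : H} (hc : HasSum (fun i => c i • e i) f) (hs : Summable fun i => ‖c i‖ ^ 2) :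
    ‖f‖ ^ 2 ≤ B * ∑' i, ‖c i‖ ^ 2 :=
  le_of_tendsto_of_tendsto' (hc.norm.pow 2) (Filter.Tendsto.const_mul B hs.hasSum)
    fun S => hu S c

theorem summable_smul_of_upper_bound [CompleteSpace H] {e : ι → H} {B : ℝ} (hB : 0 < B)
    (hu : ∀ (S : Finset ι) (c : ι → ℂ), ‖∑ i ∈ S, c i • e i‖ ^ 2 ≤ B * ∑ i ∈ S, ‖c i‖ ^ 2)
    {c : ι → ℂ} (hs : Summable fun i => ‖c i‖ ^ 2) : Summable fun i => c i • e i := by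
  rw [summable_iff_vanishing_norm]
  intro ε hε
  obtain ⟨s, hs⟩ := summable_iff_vanishing_norm.mp hs (ε ^ 2 / B) (by positivity)
  refine ⟨s, fun t ht => ?_⟩
  have h1 := (le_abs_self _).trans_lt (hs t ht)
  rw [lt_div_iff₀ hB, mul_comm] at h1
  exact lt_of_pow_lt_pow_left₀ 2 hε.le ((hu t c).trans_lt h1)

/-- A complete family with two-sided bounds on finite linear combinations is a Riesz basis. -/
theorem isRieszBasis_of_bounds [CompleteSpace H] {e : ι → H} {A B : ℝ} (hA : 0 < A) (hAB : A ≤ B)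
    (hl : ∀ (S : Finset ι) (c : ι → ℂ), A * ∑ i ∈ S, ‖c i‖ ^ 2 ≤ ‖∑ i ∈ S, c i • e i‖ ^ 2)
    (hu : ∀ (S : Finset ι) (c : ι → ℂ), ‖∑ i ∈ S, c i • e i‖ ^ 2 ≤ B * ∑ i ∈ S, ‖c i‖ ^ 2)
    (hcomplete : ∀ f : H, (∀ i, inner ℂ (e i) f = 0) → f = 0) : IsRieszBasis e := by
  classical
  have hB : 0 < B := hA.trans_le hAB
  have hsq : ∀ c : lp (fun _ : ι => ℂ) 2, HasSum (fun i => ‖c i‖ ^ 2) (‖c‖ ^ 2) := fun c => by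
    simpa using lp.hasSum_norm (p := 2) (by simp) c
  have hT : ∀ c : lp (fun _ : ι => ℂ) 2, HasSum (fun i => c i • e i) (∑' i, c i • e i) :=
    fun c => (summable_smul_of_upper_bound hB hu (hsq c).summable).hasSum
  -- The synthesis operator on `ℓ²`; the two bounds make it continuous and bounded below.
  let T₀ : lp (fun _ : ι => ℂ) 2 →ₗ[ℂ] H :=
    { toFun := fun c => ∑' i, c i • e i
      map_add' := fun c c' => by
        refine HasSum.tsum_eq ?_
        simpa [add_smul] using (hT c).add (hT c')
      map_smul' := fun r c => by
        refine HasSum.tsum_eq ?_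
        simpa [mul_smul] using (hT c).const_smul r }
  have hup : ∀ c, ‖T₀ c‖ ≤ √B * ‖c‖ := fun c => by
    rw [← Real.sqrt_sq (norm_nonneg c), ← Real.sqrt_mul hB.le]
    refine Real.le_sqrt_of_sq_le ?_
    rw [← (hsq c).tsum_eq]
    exact norm_sq_le_of_hasSum_smul hu (hT c) (hsq c).summable
  have hlow : ∀ c, ‖c‖ ≤ √A⁻¹ * ‖T₀ c‖ := fun c => by
    rw [← Real.sqrt_sq (norm_nonneg (T₀ c)), ← Real.sqrt_mul (inv_pos.mpr hA).le]
    refine Real.le_sqrt_of_sq_le ?_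
    rw [le_inv_mul_iff₀ hA, ← (hsq c).tsum_eq]
    exact le_of_hasSum_smul hl (hT c) (hsq c).summable
  let T : lp (fun _ : ι => ℂ) 2 →L[ℂ] H := T₀.mkContinuous _ hup
  have hanti : AntilipschitzWith (Real.toNNReal √A⁻¹) T :=
    AddMonoidHomClass.antilipschitz_of_bound T fun c => by
      rw [Real.coe_toNNReal _ (Real.sqrt_nonneg _)]
      exact hlow c
  have hclosed : IsClosed (T.range : Set H) := by
    exact hanti.isClosed_range T.uniformContinuous
  -- A closed range with trivial orthogonal complement is everything.
  have hrange : T.range = ⊤ := by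
    have : CompleteSpace T.range := hclosed.completeSpace_coe
    rw [← Submodule.orthogonal_eq_bot_iff, Submodule.eq_bot_iff]
    intro f hf
    refine hcomplete f fun i => ?_
    have hi : T (lp.single 2 i 1) = e i := by
      refine (hT _).unique ?_
      convert hasSum_ite_eq i (e i) using 2 with j
      by_cases hij : j = i
      · subst hij; simp
      · simp [hij, lp.single_apply]
    exact (Submodule.mem_orthogonal _ _).mp hf _ ⟨_, hi⟩
  refine ⟨B⁻¹, A⁻¹, inv_pos.mpr hB, inv_anti₀ hA hAB, fun f => ?_⟩
  obtain ⟨c, rfl⟩ : f ∈ T.range := hrange ▸ Submodule.mem_top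
  have hs := (hsq c).summable
  refine ⟨c, hT c, fun c' hc' => ?_, hs, ?_, ?_⟩
  · funext i
    -- The competing coefficients `c'` need not be square summable, so the lower bound is applied to
    -- finite partial sums containing `i` before passing to the limit.
    have hd : HasSum (fun i => (c' i - c i) • e i) 0 := by
      have h := hc'.sub (hT c)
      rw [show (T : lp (fun _ : ι => ℂ) 2 →ₗ[ℂ] H) c = ∑' i, c i • e i from rfl, sub_self] at h
      simpa only [sub_smul] using h
    have hlim := hd.norm.pow 2
    have : A * ‖c' i - c i‖ ^ 2 ≤ ‖(0 : H)‖ ^ 2 := by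
      refine ge_of_tendsto hlim ?_
      filter_upwards [Filter.eventually_ge_atTop {i}] with S hS
      refine le_trans ?_ (hl S fun i => c' i - c i)
      gcongr
      exact Finset.single_le_sum (f := fun i => ‖c' i - c i‖ ^ 2) (fun _ _ => by positivity)
        (hS (Finset.mem_singleton_self i))
    rw [norm_zero, zero_pow two_ne_zero] at this
    have h0 : ‖c' i - c i‖ ^ 2 ≤ 0 := nonpos_of_mul_nonpos_right this hA
    have := pow_eq_zero_iff (two_ne_zero) |>.mp (le_antisymm h0 (by positivity))
    exact sub_eq_zero.mp (norm_eq_zero.mp this)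
  · rw [inv_mul_le_iff₀ hB]
    exact norm_sq_le_of_hasSum_smul hu (hT c) hs
  · rw [le_inv_mul_iff₀ hA]
    exact le_of_hasSum_smul hl (hT c) hs

end RieszCriterion

/-! ### Fourier series on the fundamental domain of a lattice -/

theorem enorm_sq_eq_lintegral {α : Type*} [MeasurableSpace α] {μ : Measure α} (f : Lp ℂ 2 μ) :
    ‖f‖ₑ ^ 2 = ∫⁻ x, ‖f x‖ₑ ^ 2 ∂μ := by
  rw [Lp.enorm_def, eLpNorm_eq_lintegral_rpow_enorm_toReal (by simp) (by simp)]
  simp only [ENNReal.toReal_ofNat, ENNReal.rpow_ofNat]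
  rw [← ENNReal.rpow_natCast, ← ENNReal.rpow_mul]
  simp

theorem memLp_two_of_lintegral_lt_top {α : Type*} [MeasurableSpace α] {μ : Measure α} {f : α → ℂ}
    (hf : AEStronglyMeasurable f μ) (h : ∫⁻ x, ‖f x‖ₑ ^ 2 ∂μ < ∞) : MemLp f 2 μ := by
  refine ⟨hf, ?_⟩
  rw [eLpNorm_lt_top_iff_lintegral_rpow_enorm_lt_top (by simp) (by simp)]
  simpa using h

section Fourier

variable {d : ℕ} (b : Module.Basis (Fin d) ℝ (EuclideanSpace ℝ (Fin d)))

/-- The vector with inner products `n i` against the basis vectors. -/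
noncomputable def dualVec (n : Fin d → ℤ) : EuclideanSpace ℝ (Fin d) :=
  (InnerProductSpace.toDual ℝ (EuclideanSpace ℝ (Fin d))).symm
    (LinearMap.toContinuousLinearMap (b.constr ℝ fun i => (n i : ℝ)))

theorem inner_dualVec (n : Fin d → ℤ) (x : EuclideanSpace ℝ (Fin d)) :
    inner ℝ (dualVec b n) x = ∑ i, n i * b.repr x i := by
  rw [dualVec, InnerProductSpace.toDual_symm_apply]
  simp [Module.Basis.constr_apply_fintype, mul_comm]

theorem inner_dualVec_basis (n : Fin d → ℤ) (i : Fin d) : inner ℝ (dualVec b n) (b i) = n i := by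
  classical
  simp [inner_dualVec, Finsupp.single_apply]

theorem dualVec_injective : Function.Injective (dualVec b) := fun n m h => by
  funext i
  have := inner_dualVec_basis b n i
  rw [h, inner_dualVec_basis] at this
  exact_mod_cast this.symm

theorem mem_dualLatticeOf {y : EuclideanSpace ℝ (Fin d)} :
    y ∈ dualLatticeOf b ↔ ∀ m ∈ latticeOf b, ∃ n : ℤ, (n : ℝ) = inner ℝ y m := by
  rw [dualLatticeOf, LinearMap.BilinForm.mem_dualSubmodule]
  simp only [Submodule.mem_one, innerₗ_apply_apply]
  rfl

theorem mem_dualLatticeOf_iff_exists_dualVec {y : EuclideanSpace ℝ (Fin d)} :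
    y ∈ dualLatticeOf b ↔ ∃ n, dualVec b n = y := by
  rw [mem_dualLatticeOf]
  constructor
  · intro h
    choose n hn using fun i => h (b i) (Submodule.subset_span ⟨i, rfl⟩)
    refine ⟨n, ext_inner_right ℝ fun x => ?_⟩
    rw [inner_dualVec]
    conv_rhs => rw [← b.sum_repr x, inner_sum]
    simp [real_inner_smul_right, ← hn, mul_comm]
  · rintro ⟨n, rfl⟩ m hm
    induction hm using Submodule.span_induction with
    | mem x hx => obtain ⟨i, rfl⟩ := hx; exact ⟨n i, (inner_dualVec_basis b n i).symm⟩
    | zero => exact ⟨0, by simp⟩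
    | add x y _ _ hx hy =>
      obtain ⟨p, hp⟩ := hx
      obtain ⟨p', hp'⟩ := hy
      exact ⟨p + p', by rw [inner_add_right, ← hp, ← hp']; push_cast; rfl⟩
    | smul r x _ hx =>
      obtain ⟨p, hp⟩ := hx
      refine ⟨r * p, ?_⟩
      rw [← Int.cast_smul_eq_zsmul ℝ, real_inner_smul_right, ← hp]
      push_cast
      rfl

theorem expFun_add_left (l l' x : EuclideanSpace ℝ (Fin d)) :
    expFun (l + l') x = expFun l x * expFun l' x := by
  rw [expFun, expFun, expFun, ← Complex.exp_add, inner_add_left]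
  push_cast
  ring_nf

theorem expFun_add_right (l x y : EuclideanSpace ℝ (Fin d)) :
    expFun l (x + y) = expFun l x * expFun l y := by
  rw [expFun, expFun, expFun, ← Complex.exp_add, inner_add_right]
  push_cast
  ring_nf

theorem norm_expFun (l x : EuclideanSpace ℝ (Fin d)) : ‖expFun l x‖ = 1 := by
  rw [expFun, show 2 * (Real.pi : ℂ) * Complex.I * (inner ℝ l x : ℝ) =
    ((2 * Real.pi * inner ℝ l x : ℝ) : ℂ) * Complex.I by push_cast; ring,
    Complex.norm_exp_ofReal_mul_I]

theorem continuous_expFun (l : EuclideanSpace ℝ (Fin d)) : Continuous (expFun l) := by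
  unfold expFun
  fun_prop

theorem expFun_of_mem_dualLatticeOf {y m : EuclideanSpace ℝ (Fin d)} (hy : y ∈ dualLatticeOf b)
    (hm : m ∈ latticeOf b) : expFun y m = 1 := by
  obtain ⟨n, hn⟩ := (mem_dualLatticeOf b).mp hy m hm
  rw [expFun, ← hn, Complex.exp_eq_one_iff]
  exact ⟨n, by push_cast; ring⟩

noncomputable local instance : MeasureSpace UnitAddCircle := ⟨AddCircle.haarAddCircle⟩

/-- The section of the quotient map onto the torus with values in the half-open parallelepiped. -/
noncomputable def torusSection (τ : UnitAddTorus (Fin d)) : EuclideanSpace ℝ (Fin d) :=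
  b.equivFun.symm (UnitAddTorus.measurableEquivPiIoc 0 τ).1

/-- In the basis coordinates of the section, the pairing with `dualVec b n` is `∑ n_i t_i`, the
phase of the torus character. -/
theorem mFourier_eq_expFun (n : Fin d → ℤ) (τ : UnitAddTorus (Fin d)) :
    UnitAddTorus.mFourier n τ = expFun (dualVec b n) (torusSection b τ) := by
  have hτ : ∀ i, τ i = ((b.repr (torusSection b τ) i : ℝ) : UnitAddCircle) := fun i => by
    have : b.repr (torusSection b τ) i = (AddCircle.equivIoc 1 0 (τ i)).1 := by
      rw [torusSection, ← Module.Basis.equivFun_apply, LinearEquiv.apply_symm_apply]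
      rfl
    rw [this]
    exact ((AddCircle.equivIoc 1 0).symm_apply_apply (τ i)).symm
  simp only [UnitAddTorus.mFourier, ContinuousMap.coe_mk]
  rw [expFun, inner_dualVec, Complex.ofReal_sum, Finset.mul_sum, Complex.exp_sum]
  refine Finset.prod_congr rfl fun i _ => ?_
  rw [hτ i, fourier_coe_apply]
  congr 1
  push_cast
  ring

/-- The basis map sends Lebesgue measure on `ℝ^d` to a Haar measure, hence to a multiple of the
volume. The section takes values in a product of `Ioc` intervals and the fundamental domain uses
`Ico`; they differ by a null set. -/
theorem measurePreserving_torusSection : MeasurableEmbedding (torusSection b) ∧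
    ∃ c : ℝ≥0∞, c ≠ 0 ∧ c ≠ ∞ ∧ MeasurePreserving (torusSection b) volume
      (c • volume.restrict (ZSpan.fundamentalDomain b)) := by
  let e : (Fin d → ℝ) ≃L[ℝ] EuclideanSpace ℝ (Fin d) := b.equivFun.symm.toContinuousLinearEquiv
  let E : (Fin d → ℝ) ≃ᵐ EuclideanSpace ℝ (Fin d) := e.toHomeomorph.toMeasurableEquiv
  have hHaar : (Measure.map e volume).IsAddHaarMeasure := e.isAddHaarMeasure_map volume
  obtain ⟨c, hc0, hc1, hc⟩ : ∃ c : ℝ≥0∞, c ≠ 0 ∧ c ≠ ∞ ∧ Measure.map e volume =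
      c • (volume : Measure (EuclideanSpace ℝ (Fin d))) :=
    ⟨Measure.addHaarScalarFactor (Measure.map e volume) volume,
      by simpa using (Measure.addHaarScalarFactor_pos_of_isAddHaarMeasure _ _).ne',
      ENNReal.coe_ne_top, Measure.isAddLeftInvariant_eq_smul _ _⟩
  have hmeas : MeasurableSet {x : Fin d → ℝ | ∀ i, x i ∈ Set.Ioc ((0 : Fin d → ℝ) i)
      ((0 : Fin d → ℝ) i + 1)} := MeasurableSet.univ_pi' fun i => measurableSet_Ioc
  refine ⟨(E.measurableEmbedding.comp (MeasurableEmbedding.subtype_coe hmeas)).comp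
    (UnitAddTorus.measurableEquivPiIoc 0).measurableEmbedding, c, hc0, hc1, ?_⟩
  set D' : Set (EuclideanSpace ℝ (Fin d)) := {x | ∀ i, b.repr x i ∈ Set.Ioc (0 : ℝ) (0 + 1)}
  have hpre : E ⁻¹' D' = {x : Fin d → ℝ | ∀ i, x i ∈ Set.Ioc ((0 : Fin d → ℝ) i)
      ((0 : Fin d → ℝ) i + 1)} := by
    ext x
    have : ∀ i, b.repr (E x) i = x i := fun i => by
      change b.equivFun (b.equivFun.symm x) i = x i
      rw [LinearEquiv.apply_symm_apply]
    simp [D', this]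
  have hDD' : ZSpan.fundamentalDomain b =ᵐ[volume] D' := by
    have hE : Measure.QuasiMeasurePreserving E.symm (volume : Measure (EuclideanSpace ℝ (Fin d)))
        volume := by
      refine ⟨E.symm.measurable, ?_⟩
      have h : (volume : Measure (EuclideanSpace ℝ (Fin d))) ≪ Measure.map E volume := by
        change _ ≪ Measure.map e volume
        rw [hc]
        exact Measure.absolutelyContinuous_smul hc0
      have h' := h.map E.symm.measurable
      rwa [MeasurableEquiv.map_symm_map] at h'
    have h1 : (Set.univ.pi fun i : Fin d => Set.Ico (0 : ℝ) 1) =ᵐ[volume]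
        (Set.univ.pi fun i : Fin d => Set.Ioc (0 : ℝ) 1) :=
      Measure.univ_pi_Ico_ae_eq_Icc.trans Measure.univ_pi_Ioc_ae_eq_Icc.symm
    have h2 := hE.preimage_ae_eq h1
    have h3 : ∀ x i, E.symm x i = b.repr x i := fun x i => rfl
    have h4 : ZSpan.fundamentalDomain b =
        E.symm ⁻¹' (Set.univ.pi fun i : Fin d => Set.Ico (0 : ℝ) 1) := by
      ext x
      simp [ZSpan.mem_fundamentalDomain, h3]
    have h5 : D' = E.symm ⁻¹' (Set.univ.pi fun i : Fin d => Set.Ioc (0 : ℝ) 1) := by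
      ext x
      simp [D', h3]
    rw [h4, h5]
    exact h2
  have h1 := UnitAddTorus.measurePreserving_equivPiIoc (0 : Fin d → ℝ)
  have h2 : MeasurePreserving (Subtype.val : {x : Fin d → ℝ // ∀ i, x i ∈
      Set.Ioc ((0 : Fin d → ℝ) i) ((0 : Fin d → ℝ) i + 1)} → (Fin d → ℝ))
      (Measure.comap Subtype.val volume) (volume.restrict (E ⁻¹' D')) :=
    ⟨measurable_subtype_coe, by rw [hpre]; exact map_comap_subtype_coe hmeas volume⟩
  have h3 : MeasurePreserving E (volume.restrict (E ⁻¹' D'))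
      (c • volume.restrict (ZSpan.fundamentalDomain b)) := by
    refine ⟨E.measurable, ?_⟩
    rw [← MeasurableEquiv.restrict_map, Measure.restrict_congr_set hDD']
    change (Measure.map e volume).restrict D' = _
    rw [hc, Measure.restrict_smul]
  exact h3.comp (h2.comp h1)

/-- Orthogonality of the dual lattice exponentials on the fundamental domain. -/
theorem lintegral_enorm_sum_expFun_dualVec : ∃ C : ℝ≥0∞, C ≠ 0 ∧ C ≠ ∞ ∧
    ∀ (S : Finset (Fin d → ℤ)) (c : (Fin d → ℤ) → ℂ),
      ∫⁻ x in ZSpan.fundamentalDomain b, ‖∑ n ∈ S, c n * expFun (dualVec b n) x‖ₑ ^ 2 =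
        C * ∑ n ∈ S, ‖c n‖ₑ ^ 2 := by
  obtain ⟨hemb, C, hC0, hC1, hC⟩ := measurePreserving_torusSection b
  -- The torus has mass 1, so `C⁻¹` is the volume of the fundamental domain.
  refine ⟨C⁻¹, ENNReal.inv_ne_zero.mpr hC1, ENNReal.inv_ne_top.mpr hC0, fun S c => ?_⟩
  have h1 : ∫⁻ τ, ‖∑ n ∈ S, c n * UnitAddTorus.mFourier n τ‖ₑ ^ 2 =
      C * ∫⁻ x in ZSpan.fundamentalDomain b, ‖∑ n ∈ S, c n * expFun (dualVec b n) x‖ₑ ^ 2 := by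
    rw [← smul_eq_mul, ← lintegral_smul_measure, ← hC.lintegral_comp_emb hemb]
    simp_rw [mFourier_eq_expFun b]
  have h2 : ∫⁻ τ, ‖∑ n ∈ S, c n * UnitAddTorus.mFourier n τ‖ₑ ^ 2 = ∑ n ∈ S, ‖c n‖ₑ ^ 2 := by
    have h3 : ‖∑ n ∈ S, c n • UnitAddTorus.mFourierLp (d := Fin d) 2 n‖ ^ 2 =
        ∑ n ∈ S, ‖c n‖ ^ 2 := by
      have h := UnitAddTorus.orthonormal_mFourier (d := Fin d) |>.inner_sum c c S
      rw [inner_self_eq_norm_sq_to_K] at h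
      simp_rw [RCLike.conj_mul] at h
      exact_mod_cast h
    have h4 : ‖∑ n ∈ S, c n • UnitAddTorus.mFourierLp (d := Fin d) 2 n‖ₑ ^ 2 =
        ∑ n ∈ S, ‖c n‖ₑ ^ 2 := by
      simp_rw [← ofReal_norm, ← ENNReal.ofReal_pow (norm_nonneg _)]
      rw [h3, ENNReal.ofReal_sum_of_nonneg fun _ _ => by positivity]
    rw [← h4, enorm_sq_eq_lintegral]
    refine lintegral_congr_ae ?_
    have h5 : ∀ᵐ τ, ∀ n ∈ S, (c n • UnitAddTorus.mFourierLp (d := Fin d) 2 n :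
        Lp ℂ 2 (volume : Measure (UnitAddTorus (Fin d)))) τ = c n * UnitAddTorus.mFourier n τ := by
      rw [Finset.eventually_all]
      intro n _
      filter_upwards [Lp.coeFn_smul (c n) (UnitAddTorus.mFourierLp (d := Fin d) 2 n),
        UnitAddTorus.coeFn_mFourierLp (d := Fin d) 2 n] with τ h1 h2
      rw [h1, Pi.smul_apply, h2, smul_eq_mul]
    filter_upwards [h5, Lp.coeFn_finsetSum S fun n =>
      c n • UnitAddTorus.mFourierLp (d := Fin d) 2 n] with τ h5 h6
    rw [h6, Finset.sum_apply]
    rw [Finset.sum_congr rfl h5]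
  rw [← h2, h1, ← mul_assoc, ENNReal.inv_mul_cancel hC0 hC1, one_mul]

/-- Completeness of the dual lattice exponentials on the fundamental domain. -/
theorem ae_eq_zero_of_integral_expFun_dualVec {h : EuclideanSpace ℝ (Fin d) → ℂ}
    (hh : MemLp h 2 (volume.restrict (ZSpan.fundamentalDomain b)))
    (h0 : ∀ n, ∫ x in ZSpan.fundamentalDomain b,
      starRingEnd ℂ (expFun (dualVec b n) x) * h x = 0) :
    ∀ᵐ x ∂(volume.restrict (ZSpan.fundamentalDomain b)), h x = 0 := by
  obtain ⟨hemb, C, hC0, hC1, hC⟩ := measurePreserving_torusSection b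
  have hH : MemLp (h ∘ torusSection b) 2 volume :=
    (hh.smul_measure hC1).comp_measurePreserving hC
  have hz : hH.toLp = 0 := by
    rw [← map_eq_zero_iff _ UnitAddTorus.mFourierBasis.repr.injective]
    ext n
    rw [UnitAddTorus.mFourierBasis_repr, UnitAddTorus.mFourierCoeff]
    have h1 : ∀ᵐ τ, UnitAddTorus.mFourier (-n) τ • hH.toLp _ τ =
        starRingEnd ℂ (expFun (dualVec b n) (torusSection b τ)) * h (torusSection b τ) := by
      filter_upwards [hH.coeFn_toLp] with τ h1
      rw [h1, UnitAddTorus.mFourier_neg, mFourier_eq_expFun b]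
      rfl
    rw [integral_congr_ae h1, hC.integral_comp hemb fun x =>
      starRingEnd ℂ (expFun (dualVec b n) x) * h x, integral_smul_measure, h0 n, smul_zero]
    rfl
  have h1 : ∀ᵐ τ, h (torusSection b τ) = 0 := by
    rw [Lp.eq_zero_iff_ae_eq_zero] at hz
    filter_upwards [hz, hH.coeFn_toLp] with τ h1 h2
    rw [h2] at h1
    exact h1
  have h2 : ∀ᵐ x ∂(C • volume.restrict (ZSpan.fundamentalDomain b)), h x = 0 := by
    rw [← hC.map_eq]
    exact hemb.ae_map_iff.mpr h1
  exact (Measure.ae_ennreal_smul_measure_iff hC0).mp h2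

end Fourier

/-! ### Invertible matrices of roots of unity -/

/-- The invertible matrices all of whose entries are `Q`-th roots of unity. -/
def rootMatrices (k Q : ℕ) : Set (Matrix (Fin k) (Fin k) ℂ) :=
  {A | (∀ s r, A s r ^ Q = 1) ∧ A.det ≠ 0}

theorem rootMatrices_finite (k : ℕ) {Q : ℕ} (hQ : 0 < Q) : (rootMatrices k Q).Finite := by
  have h1 : {z : ℂ | z ^ Q = 1}.Finite := by
    refine (Polynomial.nthRootsFinset Q (1 : ℂ)).finite_toSet.subset fun z hz => ?_
    exact (Polynomial.mem_nthRootsFinset hQ (1 : ℂ)).mpr hz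
  have h2 : {A : Fin k → Fin k → ℂ |
      ∀ s, A s ∈ {u : Fin k → ℂ | ∀ r, u r ∈ {z : ℂ | z ^ Q = 1}}}.Finite :=
    Set.Finite.pi' fun _ => Set.Finite.pi' fun _ => h1
  exact h2.subset fun A hA s r => hA.1 s r

/-- An injective linear map on a finite-dimensional space is bounded and bounded below. -/
theorem exists_bounds_mulVec {k : ℕ} {A : Matrix (Fin k) (Fin k) ℂ} (hA : A.det ≠ 0) :
    ∃ α β : ℝ, 0 < α ∧ ∀ c : Fin k → ℂ, α * ∑ s, ‖c s‖ ^ 2 ≤ ∑ r, ‖(A.mulVec c) r‖ ^ 2 ∧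
      ∑ r, ‖(A.mulVec c) r‖ ^ 2 ≤ β * ∑ s, ‖c s‖ ^ 2 := by
  set T : EuclideanSpace ℂ (Fin k) →ₗ[ℂ] EuclideanSpace ℂ (Fin k) := Matrix.toEuclideanLin A
  have hker : LinearMap.ker T = ⊥ := by
    rw [LinearMap.ker_eq_bot']
    intro c hc
    by_contra hne
    refine hA (Matrix.exists_mulVec_eq_zero_iff.mp ⟨c.ofLp, ?_, ?_⟩)
    · simpa using hne
    · simpa [T] using congrArg WithLp.ofLp hc
  obtain ⟨K, hK, hanti⟩ := T.exists_antilipschitzWith hker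
  set T' := LinearMap.toContinuousLinearMap T
  refine ⟨((K : ℝ) ^ 2)⁻¹, ‖T'‖ ^ 2, by positivity, fun c => ?_⟩
  have h1 : ∑ s, ‖c s‖ ^ 2 = ‖WithLp.toLp 2 c‖ ^ 2 := by
    rw [EuclideanSpace.norm_sq_eq]
  have h2 : ∑ r, ‖(A.mulVec c) r‖ ^ 2 = ‖T (WithLp.toLp 2 c)‖ ^ 2 := by
    rw [EuclideanSpace.norm_sq_eq]
    rfl
  rw [h1, h2, ← mul_pow]
  constructor
  · rw [inv_mul_le_iff₀ (by positivity), ← mul_pow]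
    gcongr
    simpa [dist_eq_norm] using hanti.le_mul_dist (WithLp.toLp 2 c) 0
  · gcongr
    exact T'.le_opNorm _

theorem exists_uniform_bounds_mulVec {k : ℕ} {S : Set (Matrix (Fin k) (Fin k) ℂ)} (hS : S.Finite)
    (hdet : ∀ A ∈ S, A.det ≠ 0) :
    ∃ α β : ℝ, 0 < α ∧ 0 < β ∧ ∀ A ∈ S, ∀ c : Fin k → ℂ,
      α * ∑ s, ‖c s‖ ^ 2 ≤ ∑ r, ‖(A.mulVec c) r‖ ^ 2 ∧
      ∑ r, ‖(A.mulVec c) r‖ ^ 2 ≤ β * ∑ s, ‖c s‖ ^ 2 := by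
  -- Every sufficiently small positive `α` works for a given matrix, so finiteness of `S` yields a
  -- common one; large `β` is treated in the same way.
  have h1 : ∀ᶠ α : ℝ in nhdsWithin 0 (Set.Ioi 0), ∀ A ∈ S, ∀ c : Fin k → ℂ,
      α * ∑ s, ‖c s‖ ^ 2 ≤ ∑ r, ‖(A.mulVec c) r‖ ^ 2 := by
    rw [Filter.eventually_all_finite hS]
    intro A hA
    obtain ⟨α, β, hα, h⟩ := exists_bounds_mulVec (hdet A hA)
    filter_upwards [Ioc_mem_nhdsGT hα] with α' hα' c
    exact (mul_le_mul_of_nonneg_right hα'.2 (by positivity)).trans (h c).1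
  have h2 : ∀ᶠ β : ℝ in Filter.atTop, ∀ A ∈ S, ∀ c : Fin k → ℂ,
      ∑ r, ‖(A.mulVec c) r‖ ^ 2 ≤ β * ∑ s, ‖c s‖ ^ 2 := by
    rw [Filter.eventually_all_finite hS]
    intro A hA
    obtain ⟨α, β, hα, h⟩ := exists_bounds_mulVec (hdet A hA)
    filter_upwards [Filter.eventually_ge_atTop β] with β' hβ' c
    exact (h c).2.trans (mul_le_mul_of_nonneg_right hβ' (by positivity))
  obtain ⟨α, hα, hα0⟩ := (h1.and self_mem_nhdsWithin).exists
  obtain ⟨β, hβ, hβ0⟩ := (h2.and (Filter.eventually_gt_atTop 0)).exists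
  exact ⟨α, β, hα0, hβ0, fun A hA c => ⟨hα A hA c, hβ A hA c⟩⟩

theorem exists_uniform_bounds_singularValues {k : ℕ} {S : Set (Matrix (Fin k) (Fin k) ℂ)}
    (hS : S.Finite) (hdet : ∀ A ∈ S, A.det ≠ 0) :
    ∃ α β : ℝ, 0 < α ∧ ∀ A ∈ S, ∀ i < k,
      (Matrix.toEuclideanLin A).singularValues i ∈ Set.Ioo α β := by
  have hpos : ∀ A ∈ S, ∀ i < k, 0 < (Matrix.toEuclideanLin A).singularValues i := by
    intro A hA i hi
    refine (LinearMap.injective_iff_forall_lt_finrank_singularValues_pos _).mp ?_ i (by simpa)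
    rw [← LinearMap.ker_eq_bot, LinearMap.ker_eq_bot']
    intro c hc
    by_contra hne
    refine hdet A hA (Matrix.exists_mulVec_eq_zero_iff.mp ⟨c.ofLp, ?_, ?_⟩)
    · simpa using hne
    · simpa using congrArg WithLp.ofLp hc
  have h1 : ∀ᶠ α : ℝ in nhdsWithin 0 (Set.Ioi 0), ∀ A ∈ S, ∀ i ∈ Set.Iio k,
      α < (Matrix.toEuclideanLin A).singularValues i := by
    rw [Filter.eventually_all_finite hS]
    intro A hA
    rw [Filter.eventually_all_finite (Set.finite_Iio k)]
    intro i hi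
    filter_upwards [Ioo_mem_nhdsGT (hpos A hA i hi)] with α hα
    exact hα.2
  have h2 : ∀ᶠ β : ℝ in Filter.atTop, ∀ A ∈ S, ∀ i ∈ Set.Iio k,
      (Matrix.toEuclideanLin A).singularValues i < β := by
    rw [Filter.eventually_all_finite hS]
    intro A hA
    rw [Filter.eventually_all_finite (Set.finite_Iio k)]
    intro i hi
    exact Filter.eventually_gt_atTop _
  obtain ⟨α, hα, hα0⟩ := (h1.and self_mem_nhdsWithin).exists
  obtain ⟨β, hβ⟩ := h2.exists
  exact ⟨α, β, hα0, fun A hA i hi => ⟨hα A hA i hi, hβ A hA i hi⟩⟩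

/-! ### Unfolding integrals over a multi-tile -/

section Unfolding

variable {d : ℕ} (b : Module.Basis (Fin d) ℝ (EuclideanSpace ℝ (Fin d)))

instance : Countable (latticeOf b) := by
  unfold latticeOf
  infer_instance

instance : VAddInvariantMeasure (latticeOf b) (EuclideanSpace ℝ (Fin d)) volume :=
  inferInstanceAs
    (VAddInvariantMeasure (latticeOf b).toAddSubgroup (EuclideanSpace ℝ (Fin d)) volume)

instance : MeasurableConstVAdd (latticeOf b) (EuclideanSpace ℝ (Fin d)) :=
  inferInstanceAs
    (MeasurableConstVAdd (latticeOf b).toAddSubgroup (EuclideanSpace ℝ (Fin d)))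

theorem isAddFundamentalDomain_latticeOf :
    IsAddFundamentalDomain (latticeOf b) (ZSpan.fundamentalDomain b) volume :=
  ZSpan.isAddFundamentalDomain b volume

theorem lintegral_eq_lintegral_tsum {G : EuclideanSpace ℝ (Fin d) → ℝ≥0∞}
    (hG : AEMeasurable G) :
    ∫⁻ x, G x = ∫⁻ x in ZSpan.fundamentalDomain b, ∑' m : latticeOf b, G (x + m) := by
  rw [(isAddFundamentalDomain_latticeOf b).lintegral_eq_tsum'', lintegral_tsum]
  · refine tsum_congr fun m => lintegral_congr fun x => ?_
    rw [add_comm]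
    rfl
  · intro m
    exact (hG.comp_quasiMeasurePreserving
      (measurePreserving_add_right volume _).quasiMeasurePreserving).restrict

theorem integral_eq_integral_tsum {G : EuclideanSpace ℝ (Fin d) → ℂ} (hG : Integrable G) :
    ∫ x, G x = ∫ x in ZSpan.fundamentalDomain b, ∑' m : latticeOf b, G (x + m) := by
  have hm : ∀ m : latticeOf b, AEStronglyMeasurable (fun x => G (x + m))
      (volume.restrict (ZSpan.fundamentalDomain b)) := fun m =>
    (hG.aestronglyMeasurable.comp_measurePreserving
      (measurePreserving_add_right volume (m : EuclideanSpace ℝ (Fin d)))).restrict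
  rw [(isAddFundamentalDomain_latticeOf b).integral_eq_tsum'' _ hG, integral_tsum hm]
  · refine tsum_congr fun m => integral_congr_ae (.of_forall fun x => ?_)
    change _ = G (x + m)
    rw [add_comm]
    rfl
  -- Interchanging sum and integral needs absolute convergence, which is the nonnegative unfolding
  -- formula applied to the norm.
  · have h := hG.hasFiniteIntegral
    rw [HasFiniteIntegral, lintegral_eq_lintegral_tsum b hG.aestronglyMeasurable.enorm,
      lintegral_tsum fun m => (hm m).enorm] at h
    exact h.ne

variable {b} {Ω : Set (EuclideanSpace ℝ (Fin d))}

theorem hasSum_indicator_of_range_eq {k : ℕ} {V : Type*} [AddCommMonoid V] [TopologicalSpace V]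
    {x : EuclideanSpace ℝ (Fin d)} {lam : Fin k → EuclideanSpace ℝ (Fin d)}
    (hinj : Function.Injective lam) (hlam : Set.range lam = freqPoints b Ω x)
    (g : EuclideanSpace ℝ (Fin d) → V) :
    HasSum (fun m : latticeOf b => Ω.indicator g (x + m)) (∑ r, g (x + lam r)) := by
  have hmem : ∀ r, lam r ∈ freqPoints b Ω x := fun r => hlam ▸ ⟨r, rfl⟩
  let i : Fin k → latticeOf b := fun r => ⟨lam r, (hmem r).1⟩
  have hi : Function.Injective i := fun r r' h => hinj (congrArg Subtype.val h)
  rw [← hi.hasSum_iff]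
  · convert hasSum_fintype (fun r => g (x + lam r)) using 2 with r
    exact Set.indicator_of_mem (hmem r).2 g
  · intro m hm
    refine Set.indicator_of_notMem (fun hx => hm ?_) g
    obtain ⟨r, hr⟩ : (m : EuclideanSpace ℝ (Fin d)) ∈ Set.range lam := hlam ▸ ⟨m.2, hx⟩
    exact ⟨r, Subtype.ext hr⟩

/-- An integral over a multi-tile, as an integral over the fundamental domain. -/
theorem setLIntegral_eq_lintegral_sum {k : ℕ} (hΩ : NullMeasurableSet Ω volume)
    {g : EuclideanSpace ℝ (Fin d) → ℝ≥0∞} (hg : AEMeasurable g (volume.restrict Ω))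
    {lam : EuclideanSpace ℝ (Fin d) → Fin k → EuclideanSpace ℝ (Fin d)}
    (hlam : ∀ᵐ x ∂(volume.restrict (ZSpan.fundamentalDomain b)),
      Function.Injective (lam x) ∧ Set.range (lam x) = freqPoints b Ω x) :
    ∫⁻ x in Ω, g x = ∫⁻ x in ZSpan.fundamentalDomain b, ∑ r, g (x + lam x r) := by
  rw [← lintegral_indicator₀ hΩ,
    lintegral_eq_lintegral_tsum b ((aemeasurable_indicator_iff₀ hΩ).mpr hg)]
  refine lintegral_congr_ae ?_
  filter_upwards [hlam] with x hx
  exact (hasSum_indicator_of_range_eq hx.1 hx.2 g).tsum_eq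

end Unfolding

/-! ### Riesz bases from uniformly invertible matrices -/

section RieszFromMatrices

variable {d k : ℕ} {b : Module.Basis (Fin d) ℝ (EuclideanSpace ℝ (Fin d))}
  {Ω : Set (EuclideanSpace ℝ (Fin d))}

theorem expMatrix_apply (a lam : Fin k → EuclideanSpace ℝ (Fin d)) (s r : Fin k) :
    expMatrix a lam s r = starRingEnd ℂ (expFun (a s) (lam r)) := by
  rw [expMatrix, Matrix.of_apply, expFun, ← Complex.exp_conj, real_inner_comm]
  simp [Complex.conj_ofNat]

/-- The matrix itself takes samples of `f` to its pairings with the exponentials, while its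
conjugate transpose takes coefficients to sample values. -/
theorem mulVec_conjTranspose_expMatrix (a lam : Fin k → EuclideanSpace ℝ (Fin d))
    (c : Fin k → ℂ) (r : Fin k) :
    ((expMatrix a lam).conjTranspose.mulVec c) r = ∑ s, c s * expFun (a s) (lam r) := by
  simp only [Matrix.mulVec, dotProduct, Matrix.conjTranspose_apply, expMatrix_apply]
  refine Finset.sum_congr rfl fun s _ => ?_
  simp [mul_comm]

theorem memLp_expFun (hfin : volume Ω < ∞) (l : EuclideanSpace ℝ (Fin d)) :
    MemLp (expFun l) 2 (volume.restrict Ω) := by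
  have : IsFiniteMeasure (volume.restrict Ω) := ⟨by simpa using hfin⟩
  exact MemLp.of_bound (continuous_expFun l).aestronglyMeasurable 1
    (.of_forall fun x => (norm_expFun l x).le)

theorem ofReal_mul_sum_enorm_sq {ι : Type*} (S : Finset ι) (α : ℝ) (hα : 0 ≤ α) (c : ι → ℂ) :
    ENNReal.ofReal (α * ∑ i ∈ S, ‖c i‖ ^ 2) = ENNReal.ofReal α * ∑ i ∈ S, ‖c i‖ₑ ^ 2 := by
  rw [ENNReal.ofReal_mul hα, ENNReal.ofReal_sum_of_nonneg fun _ _ => by positivity]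
  simp_rw [ENNReal.ofReal_pow (norm_nonneg _), ofReal_norm]

theorem ofReal_sum_enorm_sq {ι : Type*} (S : Finset ι) (c : ι → ℂ) :
    ENNReal.ofReal (∑ i ∈ S, ‖c i‖ ^ 2) = ∑ i ∈ S, ‖c i‖ₑ ^ 2 := by
  simpa using ofReal_mul_sum_enorm_sq S 1 zero_le_one c

/-- The hypothesis that `lam x` enumerates the frequency set of almost every `x` and that the
matrices `expMatrix a (lam x)` belong to a given set. -/
def EnumeratesFreq (b : Module.Basis (Fin d) ℝ (EuclideanSpace ℝ (Fin d)))
    (Ω : Set (EuclideanSpace ℝ (Fin d))) (a : Fin k → EuclideanSpace ℝ (Fin d))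
    (S : Set (Matrix (Fin k) (Fin k) ℂ))
    (lam : EuclideanSpace ℝ (Fin d) → Fin k → EuclideanSpace ℝ (Fin d)) : Prop :=
  ∀ᵐ x ∂(volume.restrict (ZSpan.fundamentalDomain b)), (Function.Injective (lam x) ∧
    Set.range (lam x) = freqPoints b Ω x) ∧ expMatrix a (lam x) ∈ S

variable {a : Fin k → EuclideanSpace ℝ (Fin d)} {S : Set (Matrix (Fin k) (Fin k) ℂ)}
  {lam : EuclideanSpace ℝ (Fin d) → Fin k → EuclideanSpace ℝ (Fin d)}

theorem exists_bounds_lintegral_sum_expFun (hΩ : NullMeasurableSet Ω volume) (hS : S.Finite)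
    (hdet : ∀ A ∈ S, A.det ≠ 0) (hlam : EnumeratesFreq b Ω a S lam) :
    ∃ α β : ℝ≥0∞, α ≠ 0 ∧ α ≠ ∞ ∧ β ≠ ∞ ∧
      ∀ (N : Finset (Fin d → ℤ)) (c : Fin k → (Fin d → ℤ) → ℂ),
        α * ∑ s, ∑ n ∈ N, ‖c s n‖ₑ ^ 2 ≤
            ∫⁻ x in Ω, ‖∑ s, ∑ n ∈ N, c s n * expFun (dualVec b n + a s) x‖ₑ ^ 2 ∧
          ∫⁻ x in Ω, ‖∑ s, ∑ n ∈ N, c s n * expFun (dualVec b n + a s) x‖ₑ ^ 2 ≤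
            β * ∑ s, ∑ n ∈ N, ‖c s n‖ₑ ^ 2 := by
  obtain ⟨α, β, hα, hβ, hbound⟩ := exists_uniform_bounds_mulVec
    (S := Matrix.conjTranspose '' S) (hS.image _) (by
      rintro _ ⟨A, hA, rfl⟩
      rw [Matrix.det_conjTranspose]
      exact star_ne_zero.mpr (hdet A hA))
  obtain ⟨C, hC0, hC1, hC⟩ := lintegral_enorm_sum_expFun_dualVec b
  refine ⟨ENNReal.ofReal α * C, ENNReal.ofReal β * C,
    mul_ne_zero (by simpa using hα) hC0, ENNReal.mul_ne_top ENNReal.ofReal_ne_top hC1,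
    ENNReal.mul_ne_top ENNReal.ofReal_ne_top hC1, fun N c => ?_⟩
  set p : Fin k → EuclideanSpace ℝ (Fin d) → ℂ :=
    fun s x => ∑ n ∈ N, c s n * expFun (dualVec b n) x with hp
  have hpm : ∀ s, Measurable fun x => ‖p s x‖ₑ ^ 2 := fun s => by
    have : Continuous (p s) := continuous_finsetSum _ fun n _ =>
      continuous_const.mul (continuous_expFun _)
    exact this.measurable.enorm.pow_const 2
  have hmeas : AEMeasurable
      (fun x => ‖∑ s, ∑ n ∈ N, c s n * expFun (dualVec b n + a s) x‖ₑ ^ 2)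
      (volume.restrict Ω) := by
    have : Continuous fun x => ∑ s, ∑ n ∈ N, c s n * expFun (dualVec b n + a s) x :=
      continuous_finsetSum _ fun s _ => continuous_finsetSum _ fun n _ =>
        continuous_const.mul (continuous_expFun _)
    exact (this.measurable.enorm.pow_const 2).aemeasurable
  have hint : ∫⁻ x in ZSpan.fundamentalDomain b, ∑ s, ‖p s x‖ₑ ^ 2 =
      C * ∑ s, ∑ n ∈ N, ‖c s n‖ₑ ^ 2 := by
    rw [lintegral_finsetSum _ fun s _ => hpm s, Finset.mul_sum]
    exact Finset.sum_congr rfl fun s _ => hC N (c s)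
  have hpt : ∀ᵐ x ∂(volume.restrict (ZSpan.fundamentalDomain b)),
      ENNReal.ofReal α * ∑ s, ‖p s x‖ₑ ^ 2 ≤
        ∑ r, ‖∑ s, ∑ n ∈ N, c s n * expFun (dualVec b n + a s) (x + lam x r)‖ₑ ^ 2 ∧
      ∑ r, ‖∑ s, ∑ n ∈ N, c s n * expFun (dualVec b n + a s) (x + lam x r)‖ₑ ^ 2 ≤
        ENNReal.ofReal β * ∑ s, ‖p s x‖ₑ ^ 2 := by
    filter_upwards [hlam] with x hx
    -- The factors `expFun (a s) x` have modulus 1, so they disappear from the coefficient norms.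
    have h := hbound _ ⟨_, hx.2, rfl⟩ fun s => expFun (a s) x * p s x
    have h1 : ∀ r, ((expMatrix a (lam x)).conjTranspose.mulVec fun s => expFun (a s) x * p s x) r =
        ∑ s, ∑ n ∈ N, c s n * expFun (dualVec b n + a s) (x + lam x r) := by
      intro r
      rw [mulVec_conjTranspose_expMatrix]
      refine Finset.sum_congr rfl fun s _ => ?_
      rw [hp, Finset.mul_sum, Finset.sum_mul]
      refine Finset.sum_congr rfl fun n _ => ?_
      have hr : lam x r ∈ freqPoints b Ω x := hx.1.2 ▸ ⟨r, rfl⟩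
      rw [expFun_add_right, expFun_add_left, expFun_add_left,
        expFun_of_mem_dualLatticeOf b ((mem_dualLatticeOf_iff_exists_dualVec b).mpr ⟨n, rfl⟩) hr.1]
      ring
    simp_rw [h1, norm_mul, norm_expFun, one_mul] at h
    rw [← ofReal_mul_sum_enorm_sq _ _ hα.le, ← ofReal_mul_sum_enorm_sq _ _ hβ.le,
      ← ofReal_sum_enorm_sq]
    exact ⟨ENNReal.ofReal_le_ofReal h.1, ENNReal.ofReal_le_ofReal h.2⟩
  rw [setLIntegral_eq_lintegral_sum hΩ hmeas (hlam.mono fun x hx => hx.1), mul_assoc, mul_assoc,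
    ← hint, ← lintegral_const_mul' _ _ ENNReal.ofReal_ne_top,
    ← lintegral_const_mul' _ _ ENNReal.ofReal_ne_top]
  exact ⟨lintegral_mono_ae (hpt.mono fun x hx => hx.1),
    lintegral_mono_ae (hpt.mono fun x hx => hx.2)⟩

/-- Orthogonality to the frequencies `Λ* + a_s` means that the lattice periodization of `conj
e_{a_s} · f` has vanishing Fourier coefficients, so it is zero almost everywhere. Up to a unimodular
factor its value at `x` is the `s`-th entry of the invertible matrix applied to the samples of `f`.
-/
theorem eq_zero_of_forall_integral_conj_expFun (hΩ : NullMeasurableSet Ω volume)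
    (hfin : volume Ω < ∞) (hdet : ∀ A ∈ S, A.det ≠ 0) (hlam : EnumeratesFreq b Ω a S lam)
    {f : EuclideanSpace ℝ (Fin d) → ℂ} (hf : MemLp f 2 (volume.restrict Ω))
    (h0 : ∀ s n, ∫ x in Ω, starRingEnd ℂ (expFun (dualVec b n + a s) x) * f x = 0) :
    ∫⁻ x in Ω, ‖f x‖ₑ ^ 2 = 0 := by
  have : IsFiniteMeasure (volume.restrict Ω) := ⟨by simpa using hfin⟩
  have hf1 : Integrable f (volume.restrict Ω) := hf.integrable (by norm_num)
  have hconj : ∀ l : EuclideanSpace ℝ (Fin d), Continuous fun x => starRingEnd ℂ (expFun l x) :=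
    fun l => Complex.continuous_conj.comp (continuous_expFun l)
  have hprod : ∀ l, Integrable (fun x => starRingEnd ℂ (expFun l x) * f x)
      (volume.restrict Ω) := fun l =>
    hf1.bdd_mul (c := 1) (hconj l).aestronglyMeasurable
      (.of_forall fun x => by rw [RCLike.norm_conj, norm_expFun])
  set G : EuclideanSpace ℝ (Fin d) → EuclideanSpace ℝ (Fin d) → ℂ :=
    fun l => Ω.indicator fun x => starRingEnd ℂ (expFun l x) * f x with hG
  have hGint : ∀ l, Integrable (G l) := fun l =>
    IntegrableOn.integrable_indicator₀ (hprod l) hΩ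
  -- Summing over the whole lattice keeps `h` measurable; nothing is assumed about measurability of
  -- `lam`.
  set h : Fin k → EuclideanSpace ℝ (Fin d) → ℂ :=
    fun s x => ∑' m : latticeOf b, G (a s) (x + m) with hh
  have hval : ∀ᵐ x ∂(volume.restrict (ZSpan.fundamentalDomain b)), ∀ s,
      h s x = ∑ r, starRingEnd ℂ (expFun (a s) (x + lam x r)) * f (x + lam x r) := by
    filter_upwards [hlam] with x hx s
    exact (hasSum_indicator_of_range_eq hx.1.1 hx.1.2 _).tsum_eq
  have hunfold : ∫⁻ x in Ω, ‖f x‖ₑ ^ 2 =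
      ∫⁻ x in ZSpan.fundamentalDomain b, ∑ r, ‖f (x + lam x r)‖ₑ ^ 2 :=
    setLIntegral_eq_lintegral_sum hΩ (hf.1.enorm.pow_const 2) (hlam.mono fun x hx => hx.1)
  have hL2 : ∫⁻ x in Ω, ‖f x‖ₑ ^ 2 < ∞ := by
    have := (eLpNorm_lt_top_iff_lintegral_rpow_enorm_lt_top (by simp) (by simp)).mp hf.2
    simpa using this
  have hmem : ∀ s, MemLp (h s) 2 (volume.restrict (ZSpan.fundamentalDomain b)) := by
    intro s
    refine memLp_two_of_lintegral_lt_top (AEStronglyMeasurable.tsum fun m =>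
      ((hGint (a s)).aestronglyMeasurable.comp_measurePreserving
        (measurePreserving_add_right volume (m : EuclideanSpace ℝ (Fin d)))).restrict) ?_
    refine lt_of_le_of_lt (b := ∫⁻ x in ZSpan.fundamentalDomain b,
      (k : ℝ≥0∞) * ∑ r, ‖f (x + lam x r)‖ₑ ^ 2) (lintegral_mono_ae ?_) ?_
    · filter_upwards [hval] with x hx
      rw [hx s]
      -- Cauchy–Schwarz for `k` terms.
      have h1 : ‖∑ r, starRingEnd ℂ (expFun (a s) (x + lam x r)) * f (x + lam x r)‖ ^ 2 ≤
          (k : ℝ) * ∑ r, ‖f (x + lam x r)‖ ^ 2 := by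
        have h2 : ‖∑ r, starRingEnd ℂ (expFun (a s) (x + lam x r)) * f (x + lam x r)‖ ≤
            ∑ r, ‖f (x + lam x r)‖ := by
          refine (norm_sum_le _ _).trans (Finset.sum_le_sum fun r _ => ?_)
          rw [norm_mul, RCLike.norm_conj, norm_expFun, one_mul]
        refine (pow_le_pow_left₀ (norm_nonneg _) h2 2).trans ?_
        simpa using sq_sum_le_card_mul_sum_sq (s := Finset.univ) (f := fun r => ‖f (x + lam x r)‖)
      have h2 := ENNReal.ofReal_le_ofReal h1
      rwa [ofReal_mul_sum_enorm_sq _ _ (by positivity), ENNReal.ofReal_pow (norm_nonneg _),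
        ofReal_norm, ENNReal.ofReal_natCast] at h2
    · rw [lintegral_const_mul' _ _ (ENNReal.natCast_ne_top k), ← hunfold]
      exact ENNReal.mul_lt_top (ENNReal.natCast_lt_top k) hL2
  have hzero : ∀ s, ∀ᵐ x ∂(volume.restrict (ZSpan.fundamentalDomain b)), h s x = 0 := by
    intro s
    refine ae_eq_zero_of_integral_expFun_dualVec b (hmem s) fun n => ?_
    rw [← h0 s n, ← integral_indicator₀ hΩ, integral_eq_integral_tsum b (hGint (dualVec b n + a s))]
    refine integral_congr_ae (.of_forall fun x => ?_)
    simp only [hh]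
    rw [← tsum_mul_left]
    refine tsum_congr fun m => ?_
    by_cases hx : x + (m : EuclideanSpace ℝ (Fin d)) ∈ Ω
    · simp only [hG, Set.indicator_of_mem hx]
      rw [expFun_add_left, expFun_add_right (dualVec b n),
        expFun_of_mem_dualLatticeOf b ((mem_dualLatticeOf_iff_exists_dualVec b).mpr ⟨n, rfl⟩) m.2]
      simp [mul_assoc]
    · simp only [hG, Set.indicator_of_notMem hx, mul_zero]
  rw [hunfold, lintegral_eq_zero_of_ae_eq_zero]
  filter_upwards [hlam, hval, ae_all_iff.mpr hzero] with x hx h1 h2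
  have h3 : (expMatrix a (lam x)).mulVec (fun r => f (x + lam x r)) = 0 := by
    funext s
    have h4 := h1 s
    rw [h2 s] at h4
    have h5 : (0 : ℂ) = starRingEnd ℂ (expFun (a s) x) *
        ((expMatrix a (lam x)).mulVec (fun r => f (x + lam x r))) s := by
      rw [h4, Matrix.mulVec, dotProduct, Finset.mul_sum]
      refine Finset.sum_congr rfl fun r _ => ?_
      rw [expFun_add_right, expMatrix_apply, map_mul]
      ring
    have h6 : starRingEnd ℂ (expFun (a s) x) ≠ 0 := by
      rw [← norm_ne_zero_iff, RCLike.norm_conj, norm_expFun]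
      exact one_ne_zero
    exact (mul_eq_zero.mp h5.symm).resolve_left h6
  have h4 : (fun r => f (x + lam x r)) = 0 := by
    by_contra hne
    exact hdet _ hx.2 (Matrix.exists_mulVec_eq_zero_iff.mp ⟨_, hne, h3⟩)
  refine Finset.sum_eq_zero fun r _ => ?_
  simp [show f (x + lam x r) = 0 from congrFun h4 r]

/-- Shifts congruent modulo the dual lattice would produce equal rows. Hence the cosets `Λ* + a_s`
are disjoint and no frequency is counted twice. -/
theorem eq_of_sub_mem_dualLatticeOf {lam : Fin k → EuclideanSpace ℝ (Fin d)}
    (hlam : ∀ r, lam r ∈ latticeOf b) (hdet : (expMatrix a lam).det ≠ 0) {s s' : Fin k}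
    (h : a s - a s' ∈ dualLatticeOf b) : s = s' := by
  by_contra hne
  refine hdet (Matrix.det_zero_of_row_eq hne (funext fun r => ?_))
  rw [expMatrix_apply, expMatrix_apply, ← sub_add_cancel (a s) (a s'), expFun_add_left,
    expFun_of_mem_dualLatticeOf b h (hlam r), one_mul]

/-- If the matrices `expMatrix a` for the enumerated frequency sets belong to a finite set of
invertible matrices, the exponentials with shifts `a` form a Riesz basis. -/
theorem isRieszBasisOfExponentials_of_enumeratesFreq (hΩ : NullMeasurableSet Ω volume)
    (hfin : volume Ω < ∞) (hS : S.Finite) (hdet : ∀ A ∈ S, A.det ≠ 0)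
    (hlam : EnumeratesFreq b Ω a S lam) :
    IsRieszBasisOfExponentials Ω (shiftedDual b (Set.range a)) := by
  classical
  have hne : (ae (volume.restrict (ZSpan.fundamentalDomain b))).NeBot := by
    rw [ae_neBot, Ne, Measure.restrict_eq_zero]
    exact ZSpan.measure_fundamentalDomain_ne_zero b
  -- The shifts do not depend on `x`, so one good point proves them incongruent.
  obtain ⟨x₀, hx₀⟩ := hlam.exists
  have hsep : ∀ s s', a s - a s' ∈ dualLatticeOf b → s = s' := fun s s' h =>
    eq_of_sub_mem_dualLatticeOf (fun r => ((hx₀.1.2 ▸ ⟨r, rfl⟩ : lam x₀ r ∈ freqPoints b Ω x₀)).1)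
      (hdet _ hx₀.2) h
  have hmemL : ∀ i : Fin k × (Fin d → ℤ),
      dualVec b i.2 + a i.1 ∈ shiftedDual b (Set.range a) := fun i => by
    simp only [shiftedDual, Set.mem_iUnion, Set.mem_range, exists_prop]
    refine ⟨a i.1, ⟨i.1, rfl⟩, ?_⟩
    change _ - _ ∈ dualLatticeOf b
    rw [add_sub_cancel_right]
    exact (mem_dualLatticeOf_iff_exists_dualVec b).mpr ⟨_, rfl⟩
  let σ₀ : Fin k × (Fin d → ℤ) → shiftedDual b (Set.range a) := fun i => ⟨_, hmemL i⟩
  have hσ : Function.Bijective σ₀ := by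
    constructor
    · rintro ⟨s, n⟩ ⟨s', n'⟩ h
      have h1 : dualVec b n + a s = dualVec b n' + a s' := congrArg Subtype.val h
      have h2 : a s - a s' = dualVec b n' - dualVec b n := by
        rw [sub_eq_sub_iff_add_eq_add, add_comm, h1]
      have h3 : s = s' := hsep s s' (h2 ▸ sub_mem
        ((mem_dualLatticeOf_iff_exists_dualVec b).mpr ⟨_, rfl⟩)
        ((mem_dualLatticeOf_iff_exists_dualVec b).mpr ⟨_, rfl⟩))
      subst h3
      rw [dualVec_injective b (add_right_cancel h1)]
    · rintro ⟨l, hl⟩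
      simp only [shiftedDual, Set.mem_iUnion, Set.mem_range, exists_prop] at hl
      obtain ⟨_, ⟨s, rfl⟩, hs⟩ := hl
      obtain ⟨n, hn⟩ := (mem_dualLatticeOf_iff_exists_dualVec b).mp hs
      exact ⟨(s, n), Subtype.ext (by simp [σ₀, hn])⟩
  let e : shiftedDual b (Set.range a) → Lp ℂ 2 (volume.restrict Ω) :=
    fun l => (memLp_expFun hfin l).toLp
  refine ⟨e, fun l => (memLp_expFun hfin l).coeFn_toLp, ?_⟩
  refine IsRieszBasis.of_comp_equiv (Equiv.ofBijective σ₀ hσ) ?_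
  obtain ⟨α, β, hα0, hα1, hβ1, hbound⟩ := exists_bounds_lintegral_sum_expFun hΩ hS hdet hlam
  have hcoe : ∀ i, (e (σ₀ i) : EuclideanSpace ℝ (Fin d) → ℂ) =ᵐ[volume.restrict Ω]
      expFun (dualVec b i.2 + a i.1) := fun i => (memLp_expFun hfin _).coeFn_toLp
  have hfinsum : ∀ (T : Finset (Fin k × (Fin d → ℤ))) (c : Fin k × (Fin d → ℤ) → ℂ),
      α * ENNReal.ofReal (∑ i ∈ T, ‖c i‖ ^ 2) ≤ ENNReal.ofReal (‖∑ i ∈ T, c i • e (σ₀ i)‖ ^ 2) ∧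
      ENNReal.ofReal (‖∑ i ∈ T, c i • e (σ₀ i)‖ ^ 2) ≤
        β * ENNReal.ofReal (∑ i ∈ T, ‖c i‖ ^ 2) := by
    intro T c
    set N := T.image Prod.snd with hN
    -- Extension by zero from `T` to a product set, the form in which the integral bounds are
    -- stated.
    set c' : Fin k → (Fin d → ℤ) → ℂ := fun s n => if (s, n) ∈ T then c (s, n) else 0 with hc'
    have hsub : T ⊆ Finset.univ ×ˢ N := fun i hi => by
      rw [Finset.mem_product]
      exact ⟨Finset.mem_univ _, Finset.mem_image_of_mem _ hi⟩
    have hsum : ∀ {V : Type} [AddCommMonoid V] (F : ℂ → Fin k × (Fin d → ℤ) → V),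
        (∀ i, F 0 i = 0) →
        ∑ i ∈ T, F (c i) i = ∑ s, ∑ n ∈ N, F (c' s n) (s, n) := by
      intro V _ F hF
      rw [← Finset.sum_product' (f := fun s n => F (c' s n) (s, n))]
      rw [← Finset.sum_subset hsub]
      · exact Finset.sum_congr rfl fun i hi => by simp [hc', hi]
      · intro i _ hi
        simp [hc', hi, hF]
    have h1 : ENNReal.ofReal (‖∑ i ∈ T, c i • e (σ₀ i)‖ ^ 2) =
        ∫⁻ x in Ω, ‖∑ s, ∑ n ∈ N, c' s n * expFun (dualVec b n + a s) x‖ₑ ^ 2 := by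
      rw [ENNReal.ofReal_pow (norm_nonneg _), ofReal_norm, enorm_sq_eq_lintegral]
      refine lintegral_congr_ae ?_
      have h5 : ∀ᵐ x ∂(volume.restrict Ω), ∀ i ∈ T, (c i • e (σ₀ i) :
          Lp ℂ 2 (volume.restrict Ω)) x = c i * expFun (dualVec b i.2 + a i.1) x := by
        rw [Finset.eventually_all]
        intro i _
        filter_upwards [Lp.coeFn_smul (c i) (e (σ₀ i)), hcoe i] with τ h1 h2
        rw [h1, Pi.smul_apply, h2, smul_eq_mul]
      filter_upwards [h5, Lp.coeFn_finsetSum T fun i => c i • e (σ₀ i)] with x h5 h6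
      rw [h6, Finset.sum_apply, Finset.sum_congr rfl h5,
        hsum (fun z i => z * expFun (dualVec b i.2 + a i.1) x) (by simp)]
    have h2 : ENNReal.ofReal (∑ i ∈ T, ‖c i‖ ^ 2) = ∑ s, ∑ n ∈ N, ‖c' s n‖ₑ ^ 2 := by
      rw [ofReal_sum_enorm_sq, hsum (fun z _ => ‖z‖ₑ ^ 2) (by simp)]
    rw [h1, h2]
    exact hbound N c'
  have hα : 0 < α.toReal := ENNReal.toReal_pos hα0 hα1
  refine isRieszBasis_of_bounds (A := α.toReal) (B := max α.toReal β.toReal) hα (le_max_left _ _)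
    (fun T c => ?_) (fun T c => ?_) fun f hf => ?_
  · have h := (hfinsum T c).1
    rw [← ENNReal.ofReal_toReal hα1, ← ENNReal.ofReal_mul hα.le,
      ENNReal.ofReal_le_ofReal_iff (by positivity)] at h
    exact h
  · have h := (hfinsum T c).2
    rw [← ENNReal.ofReal_toReal hβ1, ← ENNReal.ofReal_mul ENNReal.toReal_nonneg,
      ENNReal.ofReal_le_ofReal_iff (by positivity)] at h
    exact h.trans (mul_le_mul_of_nonneg_right (le_max_right _ _) (by positivity))
  · have hzero := eq_zero_of_forall_integral_conj_expFun hΩ hfin hdet hlam (Lp.memLp f)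
      fun s n => by
        rw [← hf (s, n), L2.inner_def]
        refine integral_congr_ae ?_
        filter_upwards [hcoe (s, n)] with x hx
        change _ = inner ℂ (e (σ₀ (s, n)) x) (f x)
        rw [hx, RCLike.inner_apply, mul_comm]
    rw [← enorm_sq_eq_lintegral] at hzero
    simpa using hzero

end RieszFromMatrices

/-! ### Admissibility -/

theorem exists_injective_range_eq {α : Type*} {s : Set α} {k : ℕ} (hs : s.Finite)
    (hk : s.ncard = k) : ∃ f : Fin k → α, Function.Injective f ∧ Set.range f = s := by
  have hcard : hs.toFinset.card = k := by rw [← hk, Set.ncard_eq_toFinset_card s hs]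
  let e := (hs.toFinset.equivFinOfCardEq hcard).symm
  refine ⟨fun i => e i, fun i i' h => e.injective (Subtype.ext h), ?_⟩
  ext y
  constructor
  · rintro ⟨i, rfl⟩
    exact hs.mem_toFinset.mp (e i).2
  · intro hy
    exact ⟨e.symm ⟨y, hs.mem_toFinset.mpr hy⟩, by simp⟩

theorem injective_of_ncard_range {α : Type*} {k : ℕ} {f : Fin k → α}
    (h : (Set.range f).ncard = k) : Function.Injective f := by
  rw [← Set.injOn_univ]
  refine Set.injOn_of_ncard_image_eq ?_
  rw [Set.image_univ, h, Set.ncard_univ, Nat.card_fin]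

section Admissible

variable {d k : ℕ} {b : Module.Basis (Fin d) ℝ (EuclideanSpace ℝ (Fin d))}
  {Ω : Set (EuclideanSpace ℝ (Fin d))} {v : Fin d → ℝ} {q : Fin d → ℕ}

/-- The phase `exp(-2πi v_l z / q_l)`. -/
noncomputable def phase (v : Fin d → ℝ) (q : Fin d → ℕ) (l : Fin d) (z : ℝ) : ℂ :=
  Complex.exp (-(2 * Real.pi * Complex.I * ((v l * z / q l : ℝ) : ℂ)))

theorem exp_neg_eq_iff {s t : ℝ} :
    Complex.exp (-(2 * Real.pi * Complex.I * (s : ℂ))) =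
      Complex.exp (-(2 * Real.pi * Complex.I * (t : ℂ))) ↔ ∃ n : ℤ, s = t + n := by
  rw [Complex.exp_eq_exp_iff_exists_int]
  have h2 : (2 * Real.pi * Complex.I : ℂ) ≠ 0 := Complex.two_pi_I_ne_zero
  constructor
  · rintro ⟨n, hn⟩
    refine ⟨-n, ?_⟩
    have : (s : ℂ) = t + ((-n : ℤ) : ℝ) := by
      apply mul_left_cancel₀ h2
      push_cast
      linear_combination -hn
    exact_mod_cast this
  · rintro ⟨n, rfl⟩
    refine ⟨-n, ?_⟩
    push_cast
    ring

theorem exp_neg_int (n : ℤ) : Complex.exp (-(2 * Real.pi * Complex.I * ((n : ℝ) : ℂ))) = 1 := by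
  have := (exp_neg_eq_iff (s := n) (t := 0)).mpr ⟨n, by simp⟩
  simpa using this

theorem phase_eq_phase_iff (hq : ∀ l, 0 < q l) {l : Fin d} {z z' : ℝ} :
    phase v q l z = phase v q l z' ↔
      ((v l * z : ℝ) : AddCircle (q l : ℝ)) = ((v l * z' : ℝ) : AddCircle (q l : ℝ)) := by
  have hql : (q l : ℝ) ≠ 0 := by exact_mod_cast (hq l).ne'
  rw [phase, phase, exp_neg_eq_iff, eq_comm, QuotientAddGroup.eq, AddSubgroup.mem_zmultiples_iff]
  refine exists_congr fun n => ?_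
  rw [zsmul_eq_mul, div_eq_iff hql, add_mul, div_mul_cancel₀ _ hql]
  constructor <;> intro h <;> linarith

/-- The consequences of strong admissibility for a single frequency set. -/
structure AdmissibleSet (v : Fin d → ℝ) (q : Fin d → ℕ) (M : Set (Fin d → ℝ)) : Prop where
  finite : M.Finite
  injOn_phase : ∀ l, ∀ w ∈ M, Set.InjOn (phase v q l) (children M l w)
  exists_int : ∀ y ∈ M, ∀ l, ∃ n : ℤ, v l * y l = n

/-- The tiling sum counts the lattice points with `x - m ∈ Ω`; negation turns these into the points
of `Λ_x`. -/
theorem IsMultiTile.finite_freqPoints (hΩ : IsMultiTile b k Ω) :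
    ∀ᵐ x, (freqPoints b Ω x).Finite ∧ (freqPoints b Ω x).ncard = k := by
  filter_upwards [hΩ.tsum_eq] with x hx
  set s : Set (latticeOf b) := {m | x - (m : EuclideanSpace ℝ (Fin d)) ∈ Ω} with hs
  have h1 : s.encard = k := by
    have : (∑' m : latticeOf b, Ω.indicator (fun _ => (1 : ℝ≥0∞))
        (x - (m : EuclideanSpace ℝ (Fin d)))) = ∑' _ : s, (1 : ℝ≥0∞) := by
      rw [tsum_subtype s fun _ => (1 : ℝ≥0∞)]
      rfl
    rw [this, ENNReal.tsum_set_one] at hx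
    exact_mod_cast hx
  have h2 : freqPoints b Ω x = (fun m : latticeOf b => -(m : EuclideanSpace ℝ (Fin d))) '' s := by
    ext y
    constructor
    · rintro ⟨hy, hyx⟩
      exact ⟨-⟨y, hy⟩, by simpa [hs] using hyx, by simp⟩
    · rintro ⟨m, hm, rfl⟩
      exact ⟨neg_mem m.2, by simpa [hs, sub_eq_add_neg] using hm⟩
  have h3 : (freqPoints b Ω x).encard = k := by
    rw [h2, Function.Injective.encard_image, h1]
    exact fun m m' h => Subtype.ext (neg_injective h)
  exact ⟨Set.finite_of_encard_eq_coe h3, by rw [Set.ncard, h3]; rfl⟩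

theorem ncard_freqSet (x : EuclideanSpace ℝ (Fin d)) :
    (freqSet b Ω x).ncard = (freqPoints b Ω x).ncard :=
  Set.ncard_image_of_injective _ (WithLp.ofLp_injective 2)

theorem self_mem_children {M : Set (Fin d → ℝ)} {y : Fin d → ℝ} (hy : y ∈ M) (l : Fin d) :
    y l ∈ children M l y :=
  ⟨y, hy, fun _ _ => rfl, rfl⟩

theorem StronglyAdmissible.admissibleSet (hadm : StronglyAdmissible b Ω v q) (hq : ∀ l, 0 < q l)
    (hΩ : IsMultiTile b k Ω) : ∀ᵐ x ∂(volume.restrict (ZSpan.fundamentalDomain b)),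
      (freqPoints b Ω x).Finite ∧ (freqPoints b Ω x).ncard = k ∧
        AdmissibleSet v q (freqSet b Ω x) := by
  filter_upwards [hadm.1, hadm.2, ae_restrict_of_ae hΩ.finite_freqPoints] with x h1 h2 h3
  have hfin : (freqSet b Ω x).Finite := h3.1.image _
  refine ⟨h3.1, h3.2, hfin, fun l w hw z hz z' hz' h => ?_, fun y hy l =>
    h2 l y hy _ (self_mem_children hy l)⟩
  -- Equal `ncard` forces injectivity only on finite sets; finiteness comes from the tiling
  -- property.
  exact Set.injOn_of_ncard_image_eq (h1 l w hw) (children_finite hfin l w) hz hz'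
    ((phase_eq_phase_iff hq).mp h)

theorem AdmissibleSet.phase_pow {M : Set (Fin d → ℝ)} (hM : AdmissibleSet v q M)
    (hq : ∀ l, 0 < q l) {y : Fin d → ℝ} (hy : y ∈ M) (l : Fin d) :
    phase v q l (y l) ^ (∏ l, q l) = 1 := by
  have h1 : phase v q l (y l) ^ q l = 1 := by
    obtain ⟨n, hn⟩ := hM.exists_int y hy l
    have hql : (q l : ℂ) ≠ 0 := by exact_mod_cast (hq l).ne'
    rw [phase, ← Complex.exp_nat_mul, ← exp_neg_int n, hn]
    congr 1
    push_cast
    field_simp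
  obtain ⟨t, ht⟩ := Finset.dvd_prod_of_mem q (Finset.mem_univ l)
  rw [ht, pow_mul, h1, one_pow]

/-- The shift `η` adds an integer to each inner product and so drops out; the diagonal part splits
over the coordinates. -/
theorem expMatrix_shiftVec_apply {η : EuclideanSpace ℝ (Fin d)} (hη : η ∈ dualLatticeOf b)
    {lam : Fin k → EuclideanSpace ℝ (Fin d)} (hlam : ∀ r, lam r ∈ latticeOf b)
    (j : Fin k → Fin d → ℕ) (s r : Fin k) :
    expMatrix (fun s => shiftVec v q η (j s)) lam s r = ∏ l, phase v q l (lam r l) ^ j s l := by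
  obtain ⟨n, hn⟩ := (mem_dualLatticeOf b).mp hη _ (hlam r)
  have h1 : (inner ℝ (lam r) (shiftVec v q η (j s)) : ℝ) =
      (∑ l, v l * lam r l / q l * j s l) + n := by
    rw [shiftVec, inner_add_right, real_inner_comm, real_inner_comm η, ← hn, PiLp.inner_apply]
    congr 1
    refine Finset.sum_congr rfl fun l _ => ?_
    simp
    ring
  have h2 : expMatrix (fun s => shiftVec v q η (j s)) lam s r =
      Complex.exp (-(2 * Real.pi * Complex.I * ((∑ l, v l * lam r l / q l * j s l : ℝ) : ℂ))) := by
    rw [expMatrix, Matrix.of_apply, h1, exp_neg_eq_iff]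
    exact ⟨n, rfl⟩
  rw [h2, Complex.ofReal_sum, Finset.mul_sum, ← Finset.sum_neg_distrib, Complex.exp_sum]
  refine Finset.prod_congr rfl fun l _ => ?_
  rw [phase, ← Complex.exp_nat_mul]
  congr 1
  push_cast
  ring

/-- The matrices for the shifts `δ j + η` with `j` in the shift index set are invertible matrices
of roots of unity. -/
theorem AdmissibleSet.expMatrix_shiftVec_mem {x : EuclideanSpace ℝ (Fin d)}
    (hM : AdmissibleSet v q (freqSet b Ω x)) (hq : ∀ l, 0 < q l)
    {η : EuclideanSpace ℝ (Fin d)} (hη : η ∈ dualLatticeOf b)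
    {lam : Fin k → EuclideanSpace ℝ (Fin d)} (hlam : Set.range lam = freqPoints b Ω x)
    {j : Fin k → Fin d → ℕ} (hj : Function.Injective j)
    (hjr : Set.range j = shiftIndex d (freqSet b Ω x)) :
    expMatrix (fun s => shiftVec v q η (j s)) lam ∈ rootMatrices k (∏ l, q l) := by
  classical
  have hmem : ∀ r, lam r ∈ freqPoints b Ω x := fun r => hlam ▸ ⟨r, rfl⟩
  have happ := expMatrix_shiftVec_apply (v := v) (q := q) hη (fun r => (hmem r).1) j
  refine ⟨fun s r => ?_, fun hdet => ?_⟩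
  · rw [happ, ← Finset.prod_pow]
    refine Finset.prod_eq_one fun l _ => ?_
    rw [← pow_mul, mul_comm, pow_mul, hM.phase_pow hq ⟨lam r, hmem r, rfl⟩ l, one_pow]
  -- A left null vector is a combination of the monomials that vanishes on all of `Λ_x`.
  · obtain ⟨c, hc, h0⟩ := Matrix.exists_vecMul_eq_zero_iff.mpr hdet
    refine hc (funext fun s => ?_)
    have hK : (shiftIndex_finite hM.finite).toFinset = Finset.univ.image j := by
      apply Finset.coe_injective
      rw [Set.Finite.coe_toFinset, ← hjr]
      simp
    have h := coeff_eq_zero_of_sum_shiftIndex hM.finite (phase v q) hM.injOn_phase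
      (fun i => ∑ s, if j s = i then c s else 0) ?_ (j s) (hjr ▸ ⟨s, rfl⟩)
    · simpa [hj.eq_iff] using h
    · rintro _ ⟨y, hy, rfl⟩
      obtain ⟨r, rfl⟩ : y ∈ Set.range lam := hlam ▸ hy
      have hr := congrFun h0 r
      rw [Matrix.vecMul, dotProduct, Pi.zero_apply] at hr
      rw [hK, Finset.sum_image fun _ _ _ _ h => hj h]
      refine (Finset.sum_congr rfl fun s _ => ?_).trans hr
      rw [happ]
      simp [hj.eq_iff]

/-- Two points of an admissible set have different phases at the first coordinate at which they
differ. -/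
theorem AdmissibleSet.exists_phase_ne {M : Set (Fin d → ℝ)} (hM : AdmissibleSet v q M)
    {y y' : Fin d → ℝ} (hy : y ∈ M) (hy' : y' ∈ M) (hne : y ≠ y') :
    ∃ l, (∀ i < l, y i = y' i) ∧ phase v q l (y l) ≠ phase v q l (y' l) := by
  obtain ⟨l₀, hl₀⟩ := Function.ne_iff.mp hne
  obtain ⟨l, hl, hmin⟩ := (Set.toFinite {l | y l ≠ y' l}).exists_minimal ⟨l₀, hl₀⟩
  have hlt : ∀ i < l, y i = y' i := fun i hi => by
    by_contra hcon
    exact absurd (hmin hcon hi.le) (not_le.mpr hi)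
  refine ⟨l, hlt, fun h => hl ?_⟩
  exact hM.injOn_phase l y hy (self_mem_children hy l)
    ⟨y', hy', fun i hi => (hlt i hi).symm, rfl⟩ h

/-- The vector with entries `v_l / (q_l q_{l+1} ⋯ q_d)`, whose multiples serve as shifts for every
admissible set. -/
noncomputable def radixVec (v : Fin d → ℝ) (q : Fin d → ℕ) : EuclideanSpace ℝ (Fin d) :=
  WithLp.toLp 2 fun l => v l / (∏ i ∈ Finset.Ici l, q i : ℕ)

/-- Mixed-radix argument. Let `l` be the first coordinate at which `y` and `y'` differ, and `Q_i =
q_i ⋯ q_d`. If the exponentials agreed, `∑ (n_i - n'_i) / Q_i` would be an integer, with `n_i = v_i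
y_i`. After multiplication by `Q_l` the terms before `l` vanish and those after `l` are multiples of
`q_l`, because `q_l Q_i` divides `Q_l`. Thus `n_l ≡ n'_l` modulo `q_l`, contradicting admissibility.
-/
theorem AdmissibleSet.exp_radixVec_injOn {M : Set (Fin d → ℝ)} (hM : AdmissibleSet v q M)
    (hq : ∀ l, 0 < q l) : Set.InjOn (fun y : Fin d → ℝ => Complex.exp
      (-(2 * Real.pi * Complex.I * (inner ℝ (WithLp.toLp 2 y) (radixVec v q) : ℝ)))) M := by
  intro y hy y' hy' h
  by_contra hne
  obtain ⟨l, hl, hphase⟩ := hM.exists_phase_ne hy hy' hne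
  obtain ⟨p, hp⟩ := exp_neg_eq_iff.mp h
  choose n hn using hM.exists_int y hy
  choose n' hn' using hM.exists_int y' hy'
  set Q : Fin d → ℕ := fun l => ∏ i ∈ Finset.Ici l, q i with hQ
  have hQ0 : ∀ i, (Q i : ℝ) ≠ 0 := fun i => by
    exact_mod_cast (Finset.prod_pos fun i _ => hq i).ne'
  have hdvd : ∀ i, l < i → ∃ t : ℕ, Q l = q l * t * Q i := by
    intro i hi
    have h1 : Q l = q l * ∏ i ∈ (Finset.Ici l).erase l, q i :=
      (Finset.mul_prod_erase _ _ (Finset.mem_Ici.mpr le_rfl)).symm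
    obtain ⟨t, ht⟩ : Q i ∣ ∏ i ∈ (Finset.Ici l).erase l, q i := by
      refine Finset.prod_dvd_prod_of_subset _ _ _ fun m hm => ?_
      have := Finset.mem_Ici.mp hm
      exact Finset.mem_erase.mpr ⟨(hi.trans_le this).ne', Finset.mem_Ici.mpr (hi.le.trans this)⟩
    exact ⟨t, by rw [h1, ht]; ring⟩
  have hinner : ∀ (w : Fin d → ℝ) (m : Fin d → ℤ), (∀ i, v i * w i = m i) →
      (inner ℝ (WithLp.toLp 2 w) (radixVec v q) : ℝ) = ∑ i, (m i : ℝ) / Q i := by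
    intro w m hm
    rw [PiLp.inner_apply]
    refine Finset.sum_congr rfl fun i _ => ?_
    rw [← hm i, radixVec]
    simp [hQ]
    ring
  rw [hinner y n hn, hinner y' n' hn'] at hp
  have hterm : ∀ i, ∃ t : ℤ, (Q l : ℝ) * ((n i : ℝ) / Q i - n' i / Q i) =
      (if i = l then (n l - n' l : ℝ) else 0) + q l * t := by
    intro i
    rcases lt_trichotomy i l with hi | rfl | hi
    · refine ⟨0, ?_⟩
      have : (n i : ℝ) = n' i := by rw [← hn, ← hn', hl i hi]
      simp [this, hi.ne]
    · refine ⟨0, ?_⟩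
      have := hQ0 i
      simp
      field_simp
    · obtain ⟨t, ht⟩ := hdvd i hi
      refine ⟨t * (n i - n' i), ?_⟩
      have := hQ0 i
      rw [ht, if_neg hi.ne']
      push_cast
      field_simp
      ring
  choose t ht using hterm
  have hsum : (n l - n' l : ℝ) + q l * ∑ i, (t i : ℝ) = Q l * p := by
    have h1 : ∑ i, (Q l : ℝ) * ((n i : ℝ) / Q i - n' i / Q i) = Q l * p := by
      rw [← Finset.mul_sum, Finset.sum_sub_distrib, hp]
      ring
    rw [← h1, Finset.sum_congr rfl fun i _ => ht i, Finset.sum_add_distrib, Finset.mul_sum]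
    simp
  obtain ⟨t', ht'⟩ : q l ∣ Q l := Finset.dvd_prod_of_mem q (Finset.mem_Ici.mpr le_rfl)
  refine hphase (exp_neg_eq_iff.mpr ⟨t' * p - ∑ i, t i, ?_⟩)
  have hql : (q l : ℝ) ≠ 0 := by exact_mod_cast (hq l).ne'
  rw [hn, hn', div_add' _ _ _ hql]
  congr 1
  push_cast
  rw [ht'] at hsum
  push_cast at hsum
  linarith

/-- The matrices for the multiples of `radixVec` are invertible matrices of roots of unity. -/
theorem AdmissibleSet.expMatrix_radixVec_mem {x : EuclideanSpace ℝ (Fin d)}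
    (hM : AdmissibleSet v q (freqSet b Ω x)) (hq : ∀ l, 0 < q l)
    {lam : Fin k → EuclideanSpace ℝ (Fin d)} (hinj : Function.Injective lam)
    (hlam : Set.range lam = freqPoints b Ω x) :
    expMatrix (fun s : Fin k => ((s : ℕ) : ℝ) • radixVec v q) lam ∈
      rootMatrices k (∏ l, q l) := by
  have hmem : ∀ r, (lam r).ofLp ∈ freqSet b Ω x := fun r =>
    ⟨lam r, hlam ▸ ⟨r, rfl⟩, rfl⟩
  set z : Fin k → ℂ := fun r => Complex.exp
    (-(2 * Real.pi * Complex.I * (inner ℝ (lam r) (radixVec v q) : ℝ))) with hz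
  have hV : expMatrix (fun s : Fin k => ((s : ℕ) : ℝ) • radixVec v q) lam =
      (Matrix.vandermonde z).transpose := by
    ext s r
    rw [expMatrix, Matrix.of_apply, Matrix.transpose_apply, Matrix.vandermonde_apply, hz,
      ← Complex.exp_nat_mul, real_inner_smul_right]
    congr 1
    push_cast
    ring
  have hzpow : ∀ r, z r ^ (∏ l, q l) = 1 := by
    intro r
    choose n hn using hM.exists_int _ (hmem r)
    rw [hz, ← Complex.exp_nat_mul, PiLp.inner_apply, Complex.ofReal_sum, Finset.mul_sum,
      ← Finset.sum_neg_distrib, Finset.mul_sum, Complex.exp_sum]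
    refine Finset.prod_eq_one fun l _ => ?_
    -- Each denominator of `radixVec` divides the full product, so every coordinate contributes an
    -- integer phase.
    obtain ⟨t, ht⟩ : (∏ i ∈ Finset.Ici l, q i) ∣ ∏ i, q i :=
      Finset.prod_dvd_prod_of_subset _ _ _ (Finset.subset_univ _)
    have h0 : ((∏ i ∈ Finset.Ici l, q i : ℕ) : ℂ) ≠ 0 := by
      exact_mod_cast (Finset.prod_pos fun i _ => hq i).ne'
    rw [← exp_neg_int (t * n l), ht]
    congr 1
    have h1 : (inner ℝ (lam r l) (radixVec v q l) : ℝ) =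
        n l / (∏ i ∈ Finset.Ici l, q i : ℕ) := by
      rw [← hn l, radixVec]
      simp
      ring
    rw [h1]
    push_cast at h0 ⊢
    field_simp
  refine ⟨fun s r => ?_, ?_⟩
  · rw [hV, Matrix.transpose_apply, Matrix.vandermonde_apply, ← pow_mul, mul_comm, pow_mul, hzpow,
      one_pow]
  · rw [hV, Matrix.det_transpose, Matrix.det_vandermonde_ne_zero_iff]
    intro r r' h
    exact hinj (WithLp.ofLp_injective 2
      (hM.exp_radixVec_injOn hq (hmem r) (hmem r') h))

end Admissible

/-! ### Assembly of the three statements -/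

theorem mainTheorem3 {d k : ℕ} (b : Module.Basis (Fin d) ℝ (EuclideanSpace ℝ (Fin d)))
    (Ω : Set (EuclideanSpace ℝ (Fin d))) (hΩ : IsMultiTile b k Ω)
    (v : Fin d → ℝ) (q : Fin d → ℕ) (hq : ∀ l, 0 < q l) (hadm : StronglyAdmissible b Ω v q) :
    -- a Riesz basis of exponentials with `k` fixed shifts exists
    (∃ a : Fin k → EuclideanSpace ℝ (Fin d),
      IsRieszBasisOfExponentials Ω (shiftedDual b (Set.range a))) ∧
    -- the shifts `δ j + η`, `j ∈ K^d(Λ_x)`, give one if they do not depend on `x`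
    (∀ K : Set (Fin d → ℕ),
      (∀ᵐ x ∂(volume.restrict (ZSpan.fundamentalDomain b)), shiftIndex d (freqSet b Ω x) = K) →
      K.ncard = k ∧
      ∀ η ∈ dualLatticeOf b,
        IsRieszBasisOfExponentials Ω (shiftedDual b (shiftVec v q η '' K))) ∧
    -- in general, the matrices `V(x)` for these shifts have uniformly bounded singular values
    (∃ α β : ℝ, 0 < α ∧ ∀ᵐ x ∂(volume.restrict (ZSpan.fundamentalDomain b)),
      (freqPoints b Ω x).ncard = k ∧ (shiftIndex d (freqSet b Ω x)).ncard = k ∧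
      ∀ η ∈ dualLatticeOf b,
      ∀ lam : Fin k → EuclideanSpace ℝ (Fin d), Set.range lam = freqPoints b Ω x →
      ∀ j : Fin k → (Fin d → ℕ), Set.range j = shiftIndex d (freqSet b Ω x) →
      ∀ i < k,
        (Matrix.toEuclideanLin (expMatrix (fun s => shiftVec v q η (j s)) lam)).singularValues i
          ∈ Set.Ioo α β) := by
  classical
  have hae := hadm.admissibleSet hq hΩ
  have hQ : 0 < ∏ l, q l := Finset.prod_pos fun l _ => hq l
  have hS := rootMatrices_finite k hQ
  have hdet : ∀ A ∈ rootMatrices k (∏ l, q l), A.det ≠ 0 := fun A hA => hA.2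
  have hcard : ∀ {x}, AdmissibleSet v q (freqSet b Ω x) → (freqPoints b Ω x).ncard = k →
      (shiftIndex d (freqSet b Ω x)).ncard = k := fun hM hk => by
    rw [ncard_shiftIndex hM.finite, ncard_freqSet, hk]
  have hne : (ae (volume.restrict (ZSpan.fundamentalDomain b))).NeBot := by
    rw [ae_neBot, Ne, Measure.restrict_eq_zero]
    exact ZSpan.measure_fundamentalDomain_ne_zero b
  obtain ⟨lam, hlam⟩ : ∃ lam : EuclideanSpace ℝ (Fin d) → Fin k → EuclideanSpace ℝ (Fin d),
      ∀ x, (freqPoints b Ω x).Finite → (freqPoints b Ω x).ncard = k →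
        Function.Injective (lam x) ∧ Set.range (lam x) = freqPoints b Ω x := by
    -- The default value 0 is used only on the null set where `Λ_x` fails to have exactly `k`
    -- points.
    refine ⟨fun x => if h : (freqPoints b Ω x).Finite ∧ (freqPoints b Ω x).ncard = k then
      (exists_injective_range_eq h.1 h.2).choose else 0, fun x h1 h2 => ?_⟩
    simp only [h1, h2, and_self, dif_pos]
    exact (exists_injective_range_eq h1 h2).choose_spec
  refine ⟨⟨fun s => ((s : ℕ) : ℝ) • radixVec v q, ?_⟩, fun K hK => ?_, ?_⟩
  · refine isRieszBasisOfExponentials_of_enumeratesFreq (lam := lam) hΩ.nullMeasurableSet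
      hΩ.volume_lt_top hS hdet ?_
    filter_upwards [hae] with x hx
    have h := hlam x hx.1 hx.2.1
    exact ⟨h, hx.2.2.expMatrix_radixVec_mem hq h.1 h.2⟩
  · obtain ⟨x₀, hx₀, hK₀⟩ := (hae.and hK).exists
    have hKk : K.ncard = k := hK₀ ▸ hcard hx₀.2.2 hx₀.2.1
    have hKfin : K.Finite := hK₀ ▸ shiftIndex_finite hx₀.2.2.finite
    refine ⟨hKk, fun η hη => ?_⟩
    obtain ⟨j, hj, hjr⟩ := exists_injective_range_eq hKfin hKk
    rw [← hjr, ← Set.range_comp]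
    refine isRieszBasisOfExponentials_of_enumeratesFreq (lam := lam) hΩ.nullMeasurableSet
      hΩ.volume_lt_top hS hdet ?_
    filter_upwards [hae, hK] with x hx hKx
    have h := hlam x hx.1 hx.2.1
    exact ⟨h, hx.2.2.expMatrix_shiftVec_mem hq hη h.2 hj (hjr.trans hKx.symm)⟩
  -- The bounds come from the whole finite set of invertible matrices of roots of unity, hence are
  -- uniform in `x`, `η` and both enumerations.
  · obtain ⟨α, β, hα, h⟩ := exists_uniform_bounds_singularValues hS hdet
    refine ⟨α, β, hα, ?_⟩
    filter_upwards [hae] with x hx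
    have hc := hcard hx.2.2 hx.2.1
    refine ⟨hx.2.1, hc, fun η hη lam' hlam' j hjr i hi => ?_⟩
    -- Only the range of `j` is prescribed; a range of `k` elements makes `j` injective.
    exact h _ (hx.2.2.expMatrix_shiftVec_mem hq hη hlam'
      (injective_of_ncard_range (hjr ▸ hc)) hjr) i hi
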